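/- Strings are binary, and $\langle x,y\rangle = 1^{|x|}0xy$. Let $U$ be a universal Turing machine: for every Turing machine $M$ there is a string $e$ such that $U(\langle e,x\rangle)=M(x)$ for all strings $x$ for which $M(x)$ is defined. For $t:\mathbb N\to\mathbb Q$ let $C^t(x)$ be the length of a shortest string $w$ such that $U(w)$ halts and outputs $x$ within $t(|x|)$ steps ($C^t(x)=\infty$ if there is no such $w$). An $(f,g)$-time-bounded compression function is a function $q$ on strings, computed by a Turing machine, such that for all strings $x$ the computation of $q(x)$ halts within $f(|x|)$ steps, and $U(q(x))$ halts and outputs $x$ within $g(|x|)$ steps. Proposition. Suppose that $\mathrm{P}=\mathrm{NP}$. Let $p$ be a polynomial (with rational coefficients) such that $C^p(x)<\infty$ for all strings $x$. Then there are a polynomial $p'$ and a $(p',p)$-time-bounded compression function $q$ such that $|q(x)|=C^p(x)$ for all strings $x$. If, moreover, $U$ simulates every Turing machine with polynomial overhead (for every Turing machine $M$ there are a string $e$ and a polynomial $r$ such that, whenever $M(x)$ outputs $y$ within $t$ steps, $U(\langle e,x\rangle)$ outputs $y$ within $r(|x|+t)$ steps), then there are such $p'$ and $q$ for which $q$ is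 given by a program for $U$: there is a string $e$ such that, for all $x$, $U(\langle e,x\rangle)$ outputs $q(x)$ within $p'(|x|)$ steps. -/

import Mathlib

namespace TimeBoundedCompression

/-- A (deterministic, multi-stack) Turing machine whose input and output are binary strings.  Its
working alphabets, its number of stacks and its finite control are arbitrary. -/
abbrev BinTM : Type 1 := Turing.TM2ComputableAux Bool Bool

/-- The machine `M` on input `x` halts with output `y`. -/
def Outputs (M : BinTM) (x y : List Bool) : Prop :=
  Nonempty (Turing.TM2Outputs M.tm (x.map M.inputAlphabet.invFun)
    (some (y.map M.outputAlphabet.invFun)))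

/-- The machine `M` on input `x` halts with output `y` within `t` steps. -/
def OutputsWithin (M : BinTM) (x y : List Bool) (t : ℚ) : Prop :=
  ∃ n : ℕ, (n : ℚ) ≤ t ∧
    Nonempty (Turing.TM2OutputsInTime M.tm (x.map M.inputAlphabet.invFun)
      (some (y.map M.outputAlphabet.invFun)) n)

/-- The pairing function `⟨x, y⟩ = 1^|x| 0 x y` on binary strings. -/
def pair (x y : List Bool) : List Bool :=
  List.replicate x.length true ++ false :: (x ++ y)

open Classical in
/-- The class P: languages whose characteristic function is computable in polynomial time. -/
def ClassP : Set (Language Bool) :=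
  {L | Nonempty (Turing.TM2ComputableInPolyTime (id : List Bool → List Bool)
    Computability.encodeBool (fun x => decide (x ∈ L)))}

/-- The class NP: languages that have polynomially long certificates, which are checked in
polynomial time. -/
def ClassNP : Set (Language Bool) :=
  {L | ∃ (r : Polynomial ℕ) (R : Language Bool), R ∈ ClassP ∧
    ∀ x : List Bool, x ∈ L ↔ ∃ w : List Bool, w.length ≤ r.eval x.length ∧ pair x w ∈ R}

/-- `U` is universal: each Turing machine `M` has a program `e` such that `U(⟨e, x⟩) = M(x)` for
all `x` such that `M(x)` is defined. -/
def IsUniversal (U : BinTM) : Prop :=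
  ∀ M : BinTM, ∃ e : List Bool, ∀ x y : List Bool, Outputs M x y → Outputs U (pair e x) y

/-- `U` simulates each Turing machine with at most polynomial slowdown. -/
def HasPolynomialOverhead (U : BinTM) : Prop :=
  ∀ M : BinTM, ∃ (e : List Bool) (r : Polynomial ℕ), ∀ (x y : List Bool) (t : ℕ),
    OutputsWithin M x y t → OutputsWithin U (pair e x) y (r.eval (x.length + t) : ℕ)

/-- `C^t(x)`, the length of a shortest program `w` such that `U(w)` outputs `x` within `t(|x|)`
steps; it is `⊤` if there is no such program. -/
noncomputable def timeBoundedComplexity (U : BinTM) (t : ℕ → ℚ) (x : List Bool) : ℕ∞ :=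
  ⨅ (w : List Bool) (_ : OutputsWithin U w x (t x.length)), (w.length : ℕ∞)

/-- `q` is an `(f, g)`-time bounded compression function: `q(x)` is computed by a Turing machine
within `f(|x|)` steps, and `U(q(x))` halts and outputs `x` within `g(|x|)` steps. -/
def IsCompressionFunction (U : BinTM) (f g : ℕ → ℚ) (q : List Bool → List Bool) : Prop :=
  (∃ M : BinTM, ∀ x, OutputsWithin M x (q x) (f x.length)) ∧
    ∀ x, OutputsWithin U (q x) x (g x.length)

/-- The same notion where `q` is computed by the program `e` for `U`, that is,
`q(x) = U(⟨e, x⟩)`, and the steps of `q(x)` are those of `U` on `⟨e, x⟩`. -/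
def IsCompressionProgram (U : BinTM) (f g : ℕ → ℚ) (e : List Bool) (q : List Bool → List Bool) :
    Prop :=
  (∀ x, OutputsWithin U (pair e x) (q x) (f x.length)) ∧
    ∀ x, OutputsWithin U (q x) x (g x.length)

/-- The time bound `n ↦ p(n)` of a polynomial `p`. -/
noncomputable def polyBound (p : Polynomial ℚ) (n : ℕ) : ℚ := p.eval (n : ℚ)

end TimeBoundedCompression

namespace TimeBoundedCompression

open Turing Function

/-- Renames the labels of a statement. -/
def relabel {K : Type} {Γ : K → Type} {Λ Λ' σ : Type} (f : Λ → Λ') :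
    TM2.Stmt Γ Λ σ → TM2.Stmt Γ Λ' σ
  | .push k g q => .push k g (relabel f q)
  | .peek k g q => .peek k g (relabel f q)
  | .pop k g q => .pop k g (relabel f q)
  | .load g q => .load g (relabel f q)
  | .branch g q₁ q₂ => .branch g (relabel f q₁) (relabel f q₂)
  | .goto g => .goto fun v => f (g v)
  | .halt => .halt

theorem relabel_relabel {K : Type} {Γ : K → Type} {Λ Λ' Λ'' σ : Type} (f : Λ → Λ') (g : Λ' → Λ'')
    (q : TM2.Stmt Γ Λ σ) : relabel g (relabel f q) = relabel (g ∘ f) q := by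
  induction q <;> simp_all [relabel]

theorem relabel_id {K : Type} {Γ : K → Type} {Λ σ : Type} (q : TM2.Stmt Γ Λ σ) :
    relabel id q = q := by
  induction q <;> simp_all [relabel]

theorem stepAux_relabel {K : Type} [DecidableEq K] {Γ : K → Type} {Λ Λ' σ : Type} (f : Λ → Λ')
    (q : TM2.Stmt Γ Λ σ) (v : σ) (S : ∀ k, List (Γ k)) :
    TM2.stepAux (relabel f q) v S =
      ⟨(TM2.stepAux q v S).l.map f, (TM2.stepAux q v S).var, (TM2.stepAux q v S).stk⟩ := by
  induction q generalizing v S with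
  | branch g q₁ q₂ h₁ h₂ => cases h : g v <;> simp [relabel, TM2.stepAux, h, h₁, h₂]
  | _ => simp_all [relabel, TM2.stepAux]

/-- `b` is reached from `a` by `n` steps of `f`. -/
def StepsTo {α : Type} (f : α → Option α) : ℕ → α → α → Prop
  | 0, a, b => a = b
  | n + 1, a, b => ∃ c, f a = some c ∧ StepsTo f n c b

theorem StepsTo.trans {α : Type} {f : α → Option α} {m n : ℕ} {a b c : α} (h : StepsTo f m a b)
    (h' : StepsTo f n b c) : StepsTo f (m + n) a c := by
  induction m generalizing a with
  | zero => cases h; simpa using h'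
  | succ m ih =>
    obtain ⟨d, hd, h⟩ := h
    rw [Nat.add_right_comm]
    exact ⟨d, hd, ih h⟩

theorem iterate_bind_none {α : Type} (f : α → Option α) (n : ℕ) : (flip bind f)^[n] none = none := by
  induction n with
  | zero => rfl
  | succ n ih => rw [iterate_succ_apply]; exact ih

theorem stepsTo_iff_iterate {α : Type} (f : α → Option α) (n : ℕ) (a b : α) :
    StepsTo f n a b ↔ (flip bind f)^[n] (some a) = some b := by
  induction n generalizing a with
  | zero => simp [StepsTo]
  | succ n ih =>
    rw [iterate_succ_apply, StepsTo]
    change _ ↔ (flip bind f)^[n] (f a) = some b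
    cases h : f a with
    | none => simpa using (iterate_bind_none f n).symm ▸ (Option.some_ne_none b).symm
    | some c => simp [ih]

theorem StepsTo.unique {α : Type} {f : α → Option α} {m n : ℕ} {a b c : α} (h : StepsTo f m a b)
    (hb : f b = none) (h' : StepsTo f n a c) (hc : f c = none) : m = n ∧ b = c := by
  induction m generalizing a n with
  | zero =>
    cases h
    cases n with
    | zero => exact ⟨rfl, h'⟩
    | succ n => obtain ⟨d, hd, -⟩ := h'; simp [hb] at hd
  | succ m ih =>
    obtain ⟨d, hd, h⟩ := h
    cases n with
    | zero => cases h'; simp [hc] at hd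
    | succ n =>
      obtain ⟨d', hd', h'⟩ := h'
      obtain rfl : d = d' := by simpa [hd] using hd'
      obtain ⟨h1, h2⟩ := ih h h'
      exact ⟨by rw [h1], h2⟩

/-- The stacks all of which are empty, except for one. -/
def singleStack {K : Type} [DecidableEq K] {Γ : K → Type} (k : K) (l : List (Γ k)) :
    ∀ k, List (Γ k) :=
  update (fun _ => []) k l

theorem initList_eq (tm : FinTM2) (l : List (tm.Γ tm.k₀)) :
    initList tm l = ⟨some tm.main, tm.initialState, singleStack tm.k₀ l⟩ := by
  unfold initList singleStack
  congr 1
  funext k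
  by_cases h : k = tm.k₀
  · subst h; simp
  · simp [h]

theorem haltList_eq (tm : FinTM2) (l : List (tm.Γ tm.k₁)) :
    haltList tm l = ⟨none, tm.initialState, singleStack tm.k₁ l⟩ := by
  unfold haltList singleStack
  congr 1
  funext k
  by_cases h : k = tm.k₁
  · subst h; simp
  · simp [h]


theorem nonempty_outputsInTime_iff (tm : FinTM2) (x : List (tm.Γ tm.k₀)) (y : List (tm.Γ tm.k₁))
    (n : ℕ) : Nonempty (TM2OutputsInTime tm x (some y) n) ↔
      ∃ j ≤ n, StepsTo (TM2.step tm.m) j ⟨some tm.main, tm.initialState, singleStack tm.k₀ x⟩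
        ⟨none, tm.initialState, singleStack tm.k₁ y⟩ := by
  rw [← initList_eq, ← haltList_eq]
  constructor
  · rintro ⟨⟨⟨j, h⟩, hj⟩⟩
    exact ⟨j, hj, (stepsTo_iff_iterate _ _ _ _).2 h⟩
  · rintro ⟨j, hj, h⟩
    exact ⟨⟨⟨j, (stepsTo_iff_iterate _ _ _ _).1 h⟩, hj⟩⟩

theorem outputsWithin_iff (M : BinTM) (x y : List Bool) (t : ℚ) : OutputsWithin M x y t ↔
    ∃ j : ℕ, (j : ℚ) ≤ t ∧ StepsTo (TM2.step M.tm.m) j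
      ⟨some M.tm.main, M.tm.initialState, singleStack M.tm.k₀ (x.map M.inputAlphabet.symm)⟩
      ⟨none, M.tm.initialState, singleStack M.tm.k₁ (y.map M.outputAlphabet.symm)⟩ := by
  simp only [OutputsWithin, nonempty_outputsInTime_iff]
  constructor
  · rintro ⟨n, hn, j, hj, h⟩
    exact ⟨j, le_trans (by exact_mod_cast hj) hn, h⟩
  · rintro ⟨j, hj, h⟩
    exact ⟨j, hj, j, le_rfl, h⟩

/-- The stack cells that a statement pushes or pops, at most. -/
def opCount {K : Type} {Γ : K → Type} {Λ σ : Type} : TM2.Stmt Γ Λ σ → ℕ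
  | .push _ _ q => opCount q + 1
  | .peek _ _ q => opCount q
  | .pop _ _ q => opCount q + 1
  | .load _ q => opCount q
  | .branch _ q₁ q₂ => opCount q₁ + opCount q₂
  | .goto _ => 0
  | .halt => 0

theorem length_stepAux {K : Type} [DecidableEq K] {Γ : K → Type} {Λ σ : Type}
    (q : TM2.Stmt Γ Λ σ) (v : σ) (S : ∀ k, List (Γ k)) (k : K) :
    ((TM2.stepAux q v S).stk k).length ≤ (S k).length + opCount q ∧
      (S k).length ≤ ((TM2.stepAux q v S).stk k).length + opCount q := by
  induction q generalizing v S with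
  | push k' f q ih =>
    have := ih v (update S k' (f v :: S k'))
    by_cases h : k = k'
    · subst h; simp [TM2.stepAux, opCount] at *; omega
    · simp [TM2.stepAux, opCount, h] at *; omega
  | pop k' f q ih =>
    have := ih (f v (S k').head?) (update S k' (S k').tail)
    by_cases h : k = k'
    · subst h; simp [TM2.stepAux, opCount] at *; omega
    · simp [TM2.stepAux, opCount, h] at *; omega
  | branch f q₁ q₂ h₁ h₂ =>
    have := h₁ v S
    have := h₂ v S
    cases h : f v <;> simp [TM2.stepAux, opCount, h] <;> omega
  | peek k' f q ih => simpa [TM2.stepAux, opCount] using ih _ _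
  | load f q ih => simpa [TM2.stepAux, opCount] using ih _ _
  | goto | halt => simp [TM2.stepAux, opCount]

theorem exists_opCount_le (tm : FinTM2) : ∃ C, ∀ l, opCount (tm.m l) ≤ C := by
  have := tm.ΛFin
  exact ⟨Finset.univ.sup fun l => opCount (tm.m l), fun l =>
    Finset.le_sup (f := fun l => opCount (tm.m l)) (Finset.mem_univ l)⟩

theorem StepsTo.length_le {tm : FinTM2} {C : ℕ} (hC : ∀ l, opCount (tm.m l) ≤ C) {n : ℕ}
    {c d : TM2.Cfg tm.Γ tm.Λ tm.σ} (h : StepsTo (TM2.step tm.m) n c d) (k : tm.K) :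
    (c.stk k).length ≤ (d.stk k).length + C * n := by
  induction n generalizing c with
  | zero => cases h; simp
  | succ n ih =>
    obtain ⟨e, he, h⟩ := h
    have := ih h
    obtain ⟨_ | l, v, S⟩ := c
    · simp at he
    · simp only [TM2.step, Option.some.injEq] at he
      subst he
      have h1 := (length_stepAux (tm.m l) v S k).2
      have h2 := hC l
      simp only at *
      linarith

/-- The binary stacks that are available in addition to those of an embedded machine. -/
inductive Loc
  | inp | out | fst | snd | thd
  deriving DecidableEq

instance : Fintype Loc :=
  ⟨{.inp, .out, .fst, .snd, .thd}, fun i => by cases i <;> simp⟩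

/-- The registers that are available in addition to those of an embedded machine. -/
structure Reg where
  r : Option Bool
  s : Option Bool
  ok : Bool
  deriving DecidableEq, Fintype

/-- The initial contents of the registers. -/
def Reg.init : Reg := ⟨none, none, true⟩

/-- The stack alphabets of the machines that embed `M`. -/
abbrev Sym (M : BinTM) : Loc ⊕ M.tm.K → Type := Sum.elim (fun _ => Bool) M.tm.Γ

/-- The internal states of the machines that embed `M`. -/
abbrev Vars (M : BinTM) : Type := Reg × M.tm.σ

/-- The memory of a machine that embeds `M`. -/
structure State (M : BinTM) where
  reg : Reg
  var : M.tm.σ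
  loc : Loc → List Bool
  mem : ∀ k, List (M.tm.Γ k)

/-- All stacks of a state. -/
def State.stk {M : BinTM} (s : State M) : ∀ k, List (Sym M k)
  | .inl i => s.loc i
  | .inr k => s.mem k

/-- The configuration that consists of a state and a label. -/
def State.cfg {M : BinTM} {L : Type} (s : State M) (l : Option L) : TM2.Cfg (Sym M) L (Vars M) :=
  ⟨l, (s.reg, s.var), s.stk⟩

theorem update_stk_inl {M : BinTM} (s : State M) (i : Loc) (l : List Bool) :
    update s.stk (.inl i) l = { s with loc := update s.loc i l }.stk := by
  funext k
  rcases k with j | k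
  · by_cases h : j = i
    · subst h; exact (update_self _ _ _).trans (update_self j l s.loc).symm
    · refine (update_of_ne (by simpa) _ _).trans ?_
      change s.loc j = update s.loc i l j
      rw [update_of_ne h]
  · exact update_of_ne (by simp) _ _

theorem update_stk_inr {M : BinTM} (s : State M) (k : M.tm.K) (l : List (M.tm.Γ k)) :
    update s.stk (.inr k) l = { s with mem := update s.mem k l }.stk := by
  funext j
  rcases j with j | j
  · exact update_of_ne (by simp) _ _
  · by_cases h : j = k
    · subst h; exact (update_self _ _ _).trans (update_self j l s.mem).symm
    · refine (update_of_ne (by simpa) _ _).trans ?_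
      change s.mem j = update s.mem k l j
      rw [update_of_ne h]

/-- Elementary operations on states; `cpush` pushes `true` if a condition on the registers holds. -/
inductive Op (M : BinTM)
  | load (f : Reg → M.tm.σ → Reg × M.tm.σ)
  | push (i : Loc) (f : Reg → Bool)
  | cpush (i : Loc) (c : Reg → Bool)
  | pop (i : Loc) (f : Reg → Option Bool → Reg)
  | mpush (k : M.tm.K) (f : Reg → M.tm.Γ k)
  | mpop (k : M.tm.K) (f : Reg → Option (M.tm.Γ k) → Reg)

/-- The effect of an elementary operation. -/
def Op.eval {M : BinTM} : Op M → State M → State M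
  | .load f, s => { s with reg := (f s.reg s.var).1, var := (f s.reg s.var).2 }
  | .push i f, s => { s with loc := update s.loc i (f s.reg :: s.loc i) }
  | .cpush i c, s => { s with loc := update s.loc i (bif c s.reg then true :: s.loc i else s.loc i) }
  | .pop i f, s =>
    { s with reg := f s.reg (s.loc i).head?, loc := update s.loc i (s.loc i).tail }
  | .mpush k f, s => { s with mem := update s.mem k (f s.reg :: s.mem k) }
  | .mpop k f, s =>
    { s with reg := f s.reg (s.mem k).head?, mem := update s.mem k (s.mem k).tail }

/-- An elementary operation as a part of a statement. -/
def Op.toStmt {M : BinTM} {L : Type} : Op M → TM2.Stmt (Sym M) L (Vars M) →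
    TM2.Stmt (Sym M) L (Vars M)
  | .load f, q => .load (fun v => f v.1 v.2) q
  | .push i f, q => .push (.inl i) (fun v => f v.1) q
  | .cpush i c, q => .branch (fun v => c v.1) (.push (.inl i) (fun _ => true) q) q
  | .pop i f, q => .pop (.inl i) (fun v o => (f v.1 o, v.2)) q
  | .mpush k f, q => .push (.inr k) (fun v => f v.1) q
  | .mpop k f, q => .pop (.inr k) (fun v o => (f v.1 o, v.2)) q

theorem Op.stepAux_toStmt {M : BinTM} {L : Type} (o : Op M) (q : TM2.Stmt (Sym M) L (Vars M))
    (s : State M) : TM2.stepAux (o.toStmt q) (s.reg, s.var) s.stk =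
      TM2.stepAux q ((o.eval s).reg, (o.eval s).var) (o.eval s).stk := by
  cases o with
  | load f => rfl
  | push i f => exact congrArg (TM2.stepAux q _) (update_stk_inl s i _)
  | cpush i c =>
    cases h : c s.reg
    · simp [toStmt, TM2.stepAux, eval, h]
    · simp only [toStmt, TM2.stepAux, eval, h, cond_true]
      exact congrArg (TM2.stepAux q _) (update_stk_inl s i _)
  | pop i f => exact congrArg (TM2.stepAux q _) (update_stk_inl s i _)
  | mpush k f => exact congrArg (TM2.stepAux q _) (update_stk_inr s k _)
  | mpop k f => exact congrArg (TM2.stepAux q _) (update_stk_inr s k _)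

/-- The effect of a list of operations. -/
def opsEval {M : BinTM} : List (Op M) → State M → State M
  | [], s => s
  | o :: os, s => opsEval os (o.eval s)

/-- A list of operations as a part of a statement. -/
def opsStmt {M : BinTM} {L : Type} (os : List (Op M)) (q : TM2.Stmt (Sym M) L (Vars M)) :
    TM2.Stmt (Sym M) L (Vars M) :=
  os.foldr Op.toStmt q

theorem stepAux_opsStmt {M : BinTM} {L : Type} (os : List (Op M))
    (q : TM2.Stmt (Sym M) L (Vars M)) (s : State M) :
    TM2.stepAux (opsStmt os q) (s.reg, s.var) s.stk =
      TM2.stepAux q ((opsEval os s).reg, (opsEval os s).var) (opsEval os s).stk := by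
  induction os generalizing s with
  | nil => rfl
  | cons o os ih => exact (o.stepAux_toStmt _ s).trans (ih _)

/-- A piece of program, which is left by going to the label `none`. -/
structure Frag (M : BinTM) where
  Λ : Type
  fin : Fintype Λ
  entry : Λ
  code : Λ → TM2.Stmt (Sym M) (Option Λ) (Vars M)

/-- Started at the label `l` in state `s`, the fragment is left in state `s'` after at most `n`
steps. -/
def Frag.RunsFrom {M : BinTM} (F : Frag M) (l : F.Λ) (s s' : State M) (n : ℕ) : Prop :=
  ∃ j ≤ n, ∀ (L : Type) (m : L → TM2.Stmt (Sym M) L (Vars M)) (f : Option F.Λ → L),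
    (∀ l, m (f (some l)) = relabel f (F.code l)) →
      StepsTo (TM2.step m) j (s.cfg (some (f (some l)))) (s'.cfg (some (f none)))

/-- Started in state `s`, the fragment is left in state `s'` after at most `n` steps. -/
def Frag.Runs {M : BinTM} (F : Frag M) (s s' : State M) (n : ℕ) : Prop :=
  F.RunsFrom F.entry s s' n

theorem Frag.RunsFrom.mono {M : BinTM} {F : Frag M} {l : F.Λ} {s s' : State M} {n n' : ℕ}
    (h : F.RunsFrom l s s' n) (hn : n ≤ n') : F.RunsFrom l s s' n' := by
  obtain ⟨j, hj, h⟩ := h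
  exact ⟨j, hj.trans hn, h⟩

theorem Frag.Runs.mono {M : BinTM} {F : Frag M} {s s' : State M} {n n' : ℕ}
    (h : F.Runs s s' n) (hn : n ≤ n') : F.Runs s s' n' :=
  Frag.RunsFrom.mono h hn

theorem Frag.runsFrom_exit {M : BinTM} {F : Frag M} {l : F.Λ} {s s' : State M}
    (h : TM2.stepAux (F.code l) (s.reg, s.var) s.stk = s'.cfg (some none)) :
    F.RunsFrom l s s' 1 := by
  refine ⟨1, le_rfl, fun L m f hm => ⟨_, ?_, rfl⟩⟩
  simp only [State.cfg, TM2.step, hm, stepAux_relabel, h, Option.map_some]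

theorem Frag.runsFrom_step {M : BinTM} {F : Frag M} {l l' : F.Λ} {s s' s'' : State M} {n : ℕ}
    (h : TM2.stepAux (F.code l) (s.reg, s.var) s.stk = s'.cfg (some (some l')))
    (h' : F.RunsFrom l' s' s'' n) : F.RunsFrom l s s'' (n + 1) := by
  obtain ⟨j, hj, h'⟩ := h'
  refine ⟨j + 1, by omega, fun L m f hm => ⟨_, ?_, h' L m f hm⟩⟩
  simp only [State.cfg, TM2.step, hm, stepAux_relabel, h, Option.map_some]

/-- The fragment that performs a list of operations in one step. -/
def Frag.ops {M : BinTM} (os : List (Op M)) : Frag M where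
  Λ := Unit
  fin := inferInstance
  entry := ()
  code _ := opsStmt os (.goto fun _ => none)

theorem Frag.runs_ops {M : BinTM} (os : List (Op M)) (s : State M) :
    (Frag.ops os).Runs s (opsEval os s) 1 :=
  Frag.runsFrom_exit (stepAux_opsStmt os _ s)

/-- The fragment that executes `F` and then `G`. -/
def Frag.seq {M : BinTM} (F G : Frag M) : Frag M where
  Λ := F.Λ ⊕ G.Λ
  fin := @instFintypeSum _ _ F.fin G.fin
  entry := .inl F.entry
  code
    | .inl l => relabel (fun o => some (o.elim (Sum.inr G.entry) Sum.inl)) (F.code l)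
    | .inr l => relabel (Option.map Sum.inr) (G.code l)

theorem Frag.Runs.seq {M : BinTM} {F G : Frag M} {s s' s'' : State M} {n n' : ℕ}
    (h : F.Runs s s' n) (h' : G.Runs s' s'' n') : (F.seq G).Runs s s'' (n + n') := by
  obtain ⟨j, hj, h⟩ := h
  obtain ⟨j', hj', h'⟩ := h'
  refine ⟨j + j', by omega, fun L m f hm => ?_⟩
  refine (h L m (f ∘ fun o => some (o.elim (Sum.inr G.entry) Sum.inl)) fun l => ?_).trans
    (h' L m (f ∘ Option.map Sum.inr) fun l => ?_)
  · exact (hm (.inl l)).trans (relabel_relabel _ _ _)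
  · exact (hm (.inr l)).trans (relabel_relabel _ _ _)

/-- The fragment that performs the operations `os` and, as long as the registers then satisfy `c`,
executes `F` and starts again. -/
def Frag.loop {M : BinTM} (os : List (Op M)) (c : Reg → Bool) (F : Frag M) : Frag M where
  Λ := Option F.Λ
  fin := @instFintypeOption _ F.fin
  entry := none
  code
    | none => opsStmt os
        (.branch (fun v => c v.1) (.goto fun _ => some (some F.entry)) (.goto fun _ => none))
    | some l => relabel some (F.code l)

theorem Frag.runs_loop_false {M : BinTM} {os : List (Op M)} {c : Reg → Bool} (F : Frag M)
    {s : State M} (h : c (opsEval os s).reg = false) : (F.loop os c).Runs s (opsEval os s) 1 :=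
  Frag.runsFrom_exit ((stepAux_opsStmt os _ s).trans (by simp [TM2.stepAux, h, State.cfg]; rfl))

theorem Frag.Runs.loop_true {M : BinTM} {os : List (Op M)} {c : Reg → Bool} {F : Frag M}
    {s s' s'' : State M} {n n' : ℕ} (hc : c (opsEval os s).reg = true)
    (h : F.Runs (opsEval os s) s' n) (h' : (F.loop os c).Runs s' s'' n') :
    (F.loop os c).Runs s s'' (n + n' + 1) := by
  refine Frag.runsFrom_step (s' := opsEval os s) (l' := some F.entry)
    ((stepAux_opsStmt os _ s).trans (by simp [TM2.stepAux, hc, State.cfg]; rfl)) ?_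
  obtain ⟨j, hj, h⟩ := h
  obtain ⟨j', hj', h'⟩ := h'
  refine ⟨j + j', by omega, fun L m f hm => (h L m (f ∘ some) fun l => ?_).trans (h' L m f hm)⟩
  exact (hm (some l)).trans (relabel_relabel _ _ _)

/-- The machine that executes a fragment; its input and output are `Loc.inp` and `Loc.out`. -/
def Frag.machine {M : BinTM} (F : Frag M) : BinTM where
  tm :=
    letI := M.tm.kFin
    letI := M.tm.σFin
    letI := F.fin
    { K := Loc ⊕ M.tm.K
      k₀ := .inl .inp
      k₁ := .inl .out
      Γ := Sym M
      Λ := Option F.Λ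
      main := some F.entry
      σ := Vars M
      initialState := (Reg.init, M.tm.initialState)
      Γk₀Fin := inferInstanceAs (Fintype Bool)
      m := fun o => o.elim .halt F.code }
  inputAlphabet := Equiv.refl Bool
  outputAlphabet := Equiv.refl Bool

/-- The state in which the embedded machine is not active. -/
def State.rest {M : BinTM} (a : Loc → List Bool) : State M :=
  ⟨Reg.init, M.tm.initialState, a, fun _ => []⟩

theorem State.rest_stk {M : BinTM} (i : Loc) (l : List Bool) :
    (State.rest (M := M) (singleStack i l)).stk = singleStack (.inl i) l := by
  have h : (State.rest (M := M) fun _ => []).stk = fun _ => [] := by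
    funext k; cases k <;> rfl
  refine (update_stk_inl (State.rest (M := M) fun _ => []) i l).symm.trans ?_
  rw [h]
  rfl

theorem Frag.Runs.machine_outputs {M : BinTM} {F : Frag M} {x y : List Bool} {n : ℕ}
    (h : F.Runs (State.rest (singleStack .inp x)) (State.rest (singleStack .out y)) n) :
    Nonempty (TM2OutputsInTime F.machine.tm (x.map F.machine.inputAlphabet.symm)
      (some (y.map F.machine.outputAlphabet.symm)) (n + 1)) := by
  rw [nonempty_outputsInTime_iff]
  obtain ⟨j, hj, h⟩ := h
  refine ⟨j + 1, by omega, ?_⟩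
  have h := h _ F.machine.tm.m id fun l => (relabel_id _).symm
  have hx : x.map F.machine.inputAlphabet.symm = x := List.map_id x
  have hy : y.map F.machine.outputAlphabet.symm = y := List.map_id y
  rw [hx, hy]
  unfold State.cfg at h
  rw [State.rest_stk, State.rest_stk] at h
  exact h.trans ⟨_, rfl, rfl⟩

/-- A statement of the embedded machine. -/
def lift {M : BinTM} : TM2.Stmt M.tm.Γ M.tm.Λ M.tm.σ → TM2.Stmt (Sym M) (Option M.tm.Λ) (Vars M)
  | .push k f q => .push (.inr k) (fun v => f v.2) (lift q)
  | .peek k f q => .peek (.inr k) (fun v o => (v.1, f v.2 o)) (lift q)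
  | .pop k f q => .pop (.inr k) (fun v o => (v.1, f v.2 o)) (lift q)
  | .load f q => .load (fun v => (v.1, f v.2)) (lift q)
  | .branch f q₁ q₂ => .branch (fun v => f v.2) (lift q₁) (lift q₂)
  | .goto f => .goto fun v => some (f v.2)
  | .halt => .goto fun _ => none

theorem stepAux_lift {M : BinTM} (q : TM2.Stmt M.tm.Γ M.tm.Λ M.tm.σ) (s : State M) :
    TM2.stepAux (lift q) (s.reg, s.var) s.stk =
      { s with var := (TM2.stepAux q s.var s.mem).var,
               mem := (TM2.stepAux q s.var s.mem).stk }.cfg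
        (some (TM2.stepAux q s.var s.mem).l) := by
  induction q generalizing s with
  | push k f q ih =>
    exact (congrArg (TM2.stepAux (lift q) _) (update_stk_inr s k _)).trans
      (ih { s with mem := update s.mem k (f s.var :: s.mem k) })
  | pop k f q ih =>
    exact (congrArg (TM2.stepAux (lift q) _) (update_stk_inr s k _)).trans
      (ih { s with var := f s.var (s.mem k).head?, mem := update s.mem k (s.mem k).tail })
  | peek k f q ih => exact ih { s with var := f s.var (s.mem k).head? }
  | load f q ih => exact ih { s with var := f s.var }
  | branch f q₁ q₂ h₁ h₂ => cases h : f s.var <;> simp [lift, TM2.stepAux, h, h₁, h₂]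
  | goto | halt => rfl

/-- Takes a cell from the clock. -/
def tick {M : BinTM} (i : Loc) : Op M :=
  .pop i fun r o => { r with ok := r.ok && o.isSome }

theorem opsEval_tick {M : BinTM} (i : Loc) (D : ℕ) (s : State M) :
    opsEval (List.replicate D (tick i)) s =
      { s with reg := { s.reg with ok := s.reg.ok && decide (D ≤ (s.loc i).length) },
               loc := update s.loc i ((s.loc i).drop D) } := by
  induction D generalizing s with
  | zero => simp [opsEval]
  | succ D ih =>
    rw [List.replicate_succ, opsEval, ih]
    cases h : s.loc i <;> simp [tick, Op.eval, h]

/-- Runs the embedded machine as long as `ok` is set; each step takes `D` cells from the clock. -/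
def Frag.clocked {M : BinTM} (i : Loc) (D : ℕ) : Frag M where
  Λ := M.tm.Λ
  fin := M.tm.ΛFin
  entry := M.tm.main
  code l := opsStmt (List.replicate D (tick i))
    (.branch (fun v => v.1.ok) (lift (M.tm.m l)) (.goto fun _ => none))

theorem stepAux_clocked {M : BinTM} (i : Loc) (D : ℕ) (l : M.tm.Λ) (s : State M)
    (ho : s.reg.ok = true) (h : D ≤ (s.loc i).length) :
    TM2.stepAux ((Frag.clocked (M := M) i D).code l) (s.reg, s.var) s.stk =
      { s with loc := update s.loc i ((s.loc i).drop D),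
               var := (TM2.stepAux (M.tm.m l) s.var s.mem).var,
               mem := (TM2.stepAux (M.tm.m l) s.var s.mem).stk }.cfg
        (some (TM2.stepAux (M.tm.m l) s.var s.mem).l) := by
  refine (stepAux_opsStmt _ _ s).trans ?_
  rw [opsEval_tick]
  simp only [h, decide_true, Bool.and_true, TM2.stepAux, ho, cond_true]
  rw [← ho]
  exact stepAux_lift _ { s with loc := update s.loc i ((s.loc i).drop D) }

theorem stepAux_clocked_stop {M : BinTM} (i : Loc) (D : ℕ) (l : M.tm.Λ) (s : State M)
    (h : s.reg.ok = true → ¬ D ≤ (s.loc i).length) :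
    TM2.stepAux ((Frag.clocked (M := M) i D).code l) (s.reg, s.var) s.stk =
      { s with reg := { s.reg with ok := false },
               loc := update s.loc i ((s.loc i).drop D) }.cfg (some none) := by
  refine (stepAux_opsStmt _ _ s).trans ?_
  rw [opsEval_tick]
  have : (s.reg.ok && decide (D ≤ (s.loc i).length)) = false := by
    cases h' : s.reg.ok <;> simp [h'] at h ⊢; omega
  simp only [this, TM2.stepAux, State.cfg, cond_false]
  rfl

theorem Frag.runsFrom_unclocked {M : BinTM} (i : Loc) {n : ℕ} {l : M.tm.Λ} {s : State M}
    {v : M.tm.σ} {S : ∀ k, List (M.tm.Γ k)} (ho : s.reg.ok = true)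
    (h : StepsTo (TM2.step M.tm.m) n ⟨some l, s.var, s.mem⟩ ⟨none, v, S⟩) :
    (Frag.clocked (M := M) i 0).RunsFrom l s { s with var := v, mem := S } n := by
  induction n generalizing l s with
  | zero => simp [StepsTo] at h
  | succ n ih =>
    obtain ⟨c, hc, h⟩ := h
    simp only [TM2.step, Option.some.injEq] at hc
    have hs := stepAux_clocked i 0 l s ho (Nat.zero_le _)
    rw [hc] at hs
    simp only [List.drop_zero, update_eq_self] at hs
    obtain ⟨_ | l', v', S'⟩ := c
    · cases n with
      | zero => cases h; exact Frag.runsFrom_exit hs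
      | succ n => obtain ⟨d, hd, -⟩ := h; simp at hd
    · exact Frag.runsFrom_step hs (ih (s := { s with var := v', mem := S' }) ho h)

theorem Frag.exists_runsFrom_clocked {M : BinTM} (i : Loc) {C D : ℕ} (hD : 0 < D)
    (hC : ∀ l, opCount (M.tm.m l) ≤ C) (T : ℕ) (l : M.tm.Λ) (s : State M)
    (hT : (s.loc i).length = T) :
    ∃ s' : State M, (Frag.clocked i D).RunsFrom l s s' (T + 1) ∧
      (∀ k, (s'.mem k).length ≤ (s.mem k).length + C * (T + 1)) ∧
      s'.reg = { s.reg with ok := s'.reg.ok } ∧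
      (∃ n, s'.loc = update s.loc i ((s.loc i).drop n)) ∧
      (s'.reg.ok = true ↔ s.reg.ok = true ∧ ∃ n v S, D * n ≤ T ∧
        StepsTo (TM2.step M.tm.m) n ⟨some l, s.var, s.mem⟩ ⟨none, v, S⟩) ∧
      (s'.reg.ok = true → ∃ n, StepsTo (TM2.step M.tm.m) n ⟨some l, s.var, s.mem⟩
        ⟨none, s'.var, s'.mem⟩) := by
  induction T using Nat.strong_induction_on generalizing l s with
  | _ T ih =>
  by_cases hs : s.reg.ok = true ∧ D ≤ (s.loc i).length
  · obtain ⟨ho, hd⟩ := hs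
    have hs := stepAux_clocked i D l s ho hd
    have hlen := fun k => (length_stepAux (M.tm.m l) s.var s.mem k).1
    generalize hc : TM2.stepAux (M.tm.m l) s.var s.mem = c at hs hlen
    obtain ⟨_ | l', v', S'⟩ := c
    · refine ⟨_, (Frag.runsFrom_exit hs).mono (by omega), fun k => ?_, rfl, ⟨D, rfl⟩, ?_, ?_⟩
      · have := hC l
        have := hlen k
        dsimp only at *
        nlinarith
      · simp only [ho, true_and, true_iff]
        exact ⟨1, v', S', by omega, _, rfl, hc⟩
      · exact fun _ => ⟨1, _, rfl, hc⟩
    · dsimp only at hs hlen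
      obtain ⟨s'', h1, h2, h3, ⟨n, h4⟩, h5, h6⟩ := ih (T - D) (by omega) l'
        { s with loc := update s.loc i ((s.loc i).drop D), var := v', mem := S' } (by simp [hT])
      refine ⟨s'', (Frag.runsFrom_step hs h1).mono (by omega), fun k => ?_, h3, ?_, ?_, ?_⟩
      · have h7 := hC l
        have := hlen k
        have := h2 k
        have h8 : C * (T - D + 1) + C ≤ C * (T + 1) := by
          rw [← Nat.mul_succ]; exact Nat.mul_le_mul_left _ (by omega)
        dsimp only at *
        omega
      · exact ⟨D + n, by rw [h4]; simp⟩
      · rw [h5]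
        dsimp only
        refine and_congr_right fun _ => ?_
        constructor
        · rintro ⟨n, v, S, hn, h⟩
          exact ⟨n + 1, v, S, by rw [Nat.mul_succ]; omega, _, congrArg some hc, h⟩
        · rintro ⟨_ | n, v, S, hn, h⟩
          · simp [StepsTo] at h
          · obtain ⟨c, hc', h⟩ := h
            simp only [TM2.step, Option.some.injEq] at hc'
            rw [← hc', hc] at h
            rw [Nat.mul_succ] at hn
            exact ⟨n, v, S, by omega, h⟩
      · intro h
        obtain ⟨n, h⟩ := h6 h
        exact ⟨n + 1, _, congrArg some hc, h⟩
  · refine ⟨_, (Frag.runsFrom_exit (stepAux_clocked_stop i D l s fun h h' => hs ⟨h, h'⟩)).mono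
      (by omega), fun k => by simp, rfl, ⟨D, rfl⟩, ?_, by simp⟩
    simp only [Bool.false_eq_true, false_iff, not_and, not_exists]
    rintro ho n v S hn h
    cases n with
    | zero => simp [StepsTo] at h
    | succ n => rw [Nat.mul_succ] at hn; exact hs ⟨ho, by omega⟩

/-- The contents of the binary stacks. -/
def locs (i o a b c : List Bool) : Loc → List Bool
  | .inp => i
  | .out => o
  | .fst => a
  | .snd => b
  | .thd => c

section locs

variable (i o a b c l : List Bool)

@[simp] theorem locs_inp : locs i o a b c .inp = i := rfl
@[simp] theorem locs_out : locs i o a b c .out = o := rfl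
@[simp] theorem locs_fst : locs i o a b c .fst = a := rfl
@[simp] theorem locs_snd : locs i o a b c .snd = b := rfl
@[simp] theorem locs_thd : locs i o a b c .thd = c := rfl

@[simp] theorem update_locs_inp : update (locs i o a b c) .inp l = locs l o a b c := by
  funext j; cases j <;> simp
@[simp] theorem update_locs_out : update (locs i o a b c) .out l = locs i l a b c := by
  funext j; cases j <;> simp
@[simp] theorem update_locs_fst : update (locs i o a b c) .fst l = locs i o l b c := by
  funext j; cases j <;> simp
@[simp] theorem update_locs_snd : update (locs i o a b c) .snd l = locs i o a l c := by
  funext j; cases j <;> simp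
@[simp] theorem update_locs_thd : update (locs i o a b c) .thd l = locs i o a b l := by
  funext j; cases j <;> simp

theorem singleStack_inp : singleStack .inp l = locs l [] [] [] [] := by
  funext j; cases j <;> simp [singleStack]
theorem singleStack_out : singleStack .out l = locs [] l [] [] [] := by
  funext j; cases j <;> simp [singleStack]

end locs

/-- Pops a stack into the first register. -/
def popR {M : BinTM} (i : Loc) : Op M := .pop i fun v o => { v with r := o }

/-- Pops a stack into the second register. -/
def popS {M : BinTM} (i : Loc) : Op M := .pop i fun v o => { v with s := o }

/-- Pushes the first register. -/
def pushR {M : BinTM} (i : Loc) : Op M := .push i fun v => v.r.getD false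

/-- Pushes the second register. -/
def pushS {M : BinTM} (i : Loc) : Op M := .push i fun v => v.s.getD false

/-- Changes the registers. -/
def loadReg {M : BinTM} (f : Reg → Reg) : Op M := .load fun v w => (f v, w)

section ops

variable {M : BinTM} (v : Reg) (w : M.tm.σ) (a : Loc → List Bool) (S : ∀ k, List (M.tm.Γ k))

@[simp] theorem opsEval_nil (s : State M) : opsEval [] s = s := rfl

@[simp] theorem opsEval_cons (o : Op M) (os : List (Op M)) (s : State M) :
    opsEval (o :: os) s = opsEval os (o.eval s) := rfl

@[simp] theorem eval_popR (i : Loc) : (popR i).eval (⟨v, w, a, S⟩ : State M) =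
    ⟨⟨(a i).head?, v.s, v.ok⟩, w, update a i (a i).tail, S⟩ := rfl

@[simp] theorem eval_popS (i : Loc) : (popS i).eval (⟨v, w, a, S⟩ : State M) =
    ⟨⟨v.r, (a i).head?, v.ok⟩, w, update a i (a i).tail, S⟩ := rfl

@[simp] theorem eval_pushR (i : Loc) : (pushR i).eval (⟨v, w, a, S⟩ : State M) =
    ⟨v, w, update a i (v.r.getD false :: a i), S⟩ := rfl

@[simp] theorem eval_pushS (i : Loc) : (pushS i).eval (⟨v, w, a, S⟩ : State M) =
    ⟨v, w, update a i (v.s.getD false :: a i), S⟩ := rfl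

@[simp] theorem eval_loadReg (f : Reg → Reg) : (loadReg f).eval (⟨v, w, a, S⟩ : State M) =
    ⟨f v, w, a, S⟩ := rfl

@[simp] theorem eval_push (i : Loc) (f : Reg → Bool) : (Op.push i f).eval (⟨v, w, a, S⟩ : State M) =
    ⟨v, w, update a i (f v :: a i), S⟩ := rfl

@[simp] theorem eval_cpush (i : Loc) (f : Reg → Bool) :
    (Op.cpush i f).eval (⟨v, w, a, S⟩ : State M) =
      ⟨v, w, update a i (bif f v then true :: a i else a i), S⟩ := rfl

@[simp] theorem eval_pop (i : Loc) (f : Reg → Option Bool → Reg) :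
    (Op.pop i f).eval (⟨v, w, a, S⟩ : State M) =
      ⟨f v (a i).head?, w, update a i (a i).tail, S⟩ := rfl

@[simp] theorem eval_mpush (k : M.tm.K) (f : Reg → M.tm.Γ k) :
    (Op.mpush k f).eval (⟨v, w, a, S⟩ : State M) = ⟨v, w, a, update S k (f v :: S k)⟩ := rfl

@[simp] theorem eval_mpop (k : M.tm.K) (f : Reg → Option (M.tm.Γ k) → Reg) :
    (Op.mpop k f).eval (⟨v, w, a, S⟩ : State M) =
      ⟨f v (S k).head?, w, a, update S k (S k).tail⟩ := rfl

end ops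

theorem Frag.runs_ops' {M : BinTM} {os : List (Op M)} {s s' : State M} (h : opsEval os s = s') :
    (Frag.ops os).Runs s s' 1 :=
  h ▸ Frag.runs_ops os s

theorem Frag.runs_loop_false' {M : BinTM} {os : List (Op M)} {c : Reg → Bool} {F : Frag M}
    {s s' : State M} (h : opsEval os s = s') (hc : c s'.reg = false) :
    (F.loop os c).Runs s s' 1 := by
  subst h; exact Frag.runs_loop_false F hc

theorem Frag.Runs.loop_true' {M : BinTM} {os : List (Op M)} {c : Reg → Bool} {F : Frag M}
    {s t s' s'' : State M} {n n' : ℕ} (h : F.Runs t s' n) (ht : opsEval os s = t)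
    (hc : c t.reg = true) (h' : (F.loop os c).Runs s' s'' n') :
    (F.loop os c).Runs s s'' (n + n' + 1) := by
  subst ht; exact Frag.Runs.loop_true hc h h'

/-- Executes `F` for each element of a stack, which is popped into the first register. -/
def Frag.each {M : BinTM} (i : Loc) (F : Frag M) : Frag M := F.loop [popR i] fun v => v.r.isSome

theorem Frag.runs_each_nil {M : BinTM} {i : Loc} {F : Frag M} {v : Reg} {w : M.tm.σ}
    {a : Loc → List Bool} {S : ∀ k, List (M.tm.Γ k)} (h : a i = []) :
    (Frag.each i F).Runs (⟨v, w, a, S⟩ : State M) ⟨⟨none, v.s, v.ok⟩, w, a, S⟩ 1 :=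
  Frag.runs_loop_false' (by
    have : update a i [] = a := by rw [← h, update_eq_self]
    simp [h, this]) rfl

theorem Frag.Runs.each_cons {M : BinTM} {i : Loc} {F : Frag M} {v : Reg} {w : M.tm.σ}
    {a : Loc → List Bool} {S : ∀ k, List (M.tm.Γ k)} {b : Bool} {l : List Bool} {s' s'' : State M}
    {n n' : ℕ} (hF : F.Runs ⟨⟨some b, v.s, v.ok⟩, w, update a i l, S⟩ s' n) (h : a i = b :: l)
    (h' : (Frag.each i F).Runs s' s'' n') :
    (Frag.each i F).Runs (⟨v, w, a, S⟩ : State M) s'' (n + n' + 1) :=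
  hF.loop_true' (by simp [h]) rfl h'

theorem Frag.Runs.congr {M : BinTM} {F : Frag M} {s t s' t' : State M} {n n' : ℕ}
    (h : F.Runs s s' n) (hs : s = t) (hs' : s' = t') (hn : n ≤ n') : F.Runs t t' n' := by
  subst hs hs'; exact h.mono hn

/-- Empties a stack. -/
def Frag.clear {M : BinTM} (i : Loc) : Frag M := Frag.each i (.ops [])

theorem Frag.runs_clear {M : BinTM} (i : Loc) (v : Reg) (w : M.tm.σ) (a : Loc → List Bool)
    (S : ∀ k, List (M.tm.Γ k)) :
    (Frag.clear i).Runs (⟨v, w, a, S⟩ : State M) ⟨⟨none, v.s, v.ok⟩, w, update a i [], S⟩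
      (2 * (a i).length + 1) := by
  generalize hl : a i = l
  induction l generalizing v a with
  | nil => exact (Frag.runs_each_nil hl).congr rfl (by simp [← hl]) le_rfl
  | cons b l ih =>
    exact ((Frag.runs_ops [] _).each_cons hl
      (ih ⟨some b, v.s, v.ok⟩ (update a i l) (by simp))).congr rfl (by simp) (by simp; omega)

theorem update_update_update_update {α β : Type} [DecidableEq α] {i k : α} (h : i ≠ k)
    (a : α → β) (x y x' y' : β) :
    update (update (update (update a k x) i y) k x') i y' = update (update a k x') i y' := by
  rw [update_comm h y x' (update a k x), update_idem, update_idem]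

/-! ### Reading the input of the verifier -/

/-- The rest of a string after the first `false`. -/
def skipOnes : List Bool → List Bool
  | [] => []
  | true :: l => skipOnes l
  | false :: l => l

/-- Reads a self-delimiting list from a string and adds it to `acc`; the second component is the
rest of the string. -/
def readList : List Bool → List Bool → List Bool × List Bool
  | acc, true :: b :: l => readList (b :: acc) l
  | acc, [true] => (false :: acc, [])
  | acc, false :: l => (acc, l)
  | acc, [] => (acc, [])

theorem skipOnes_length (l : List Bool) : (skipOnes l).length ≤ l.length := by
  induction l with
  | nil => rfl
  | cons b l ih => cases b <;> simp [skipOnes]; omega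

theorem readList_length (acc l : List Bool) :
    (readList acc l).1.length + (readList acc l).2.length ≤ acc.length + l.length := by
  fun_induction readList acc l <;> (simp_all; try omega)

/-- The self-delimiting code of a list. -/
def encodeList : List Bool → List Bool
  | [] => [false]
  | b :: l => true :: b :: encodeList l

theorem readList_encodeList (acc l r : List Bool) :
    readList acc (encodeList l ++ r) = (l.reverse ++ acc, r) := by
  induction l generalizing acc with
  | nil => simp [encodeList, readList]
  | cons b l ih => simp [encodeList, readList, ih]

theorem length_encodeList (l : List Bool) : (encodeList l).length = 2 * l.length + 1 := by
  induction l with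
  | nil => rfl
  | cons b l ih => simp [encodeList, ih]; omega

theorem skipOnes_replicate (n : ℕ) (l : List Bool) :
    skipOnes (List.replicate n true ++ false :: l) = l := by
  induction n with
  | zero => rfl
  | succ n ih => simpa [List.replicate_succ, skipOnes] using ih

/-- Removes the ones at the beginning of the input and the following zero. -/
def Frag.skip {M : BinTM} : Frag M := .loop [popR .inp] (fun v => v.r == some true) (.ops [])

theorem Frag.runs_skip {M : BinTM} (l o a b c : List Bool) (r t : Option Bool) (ok : Bool)
    (w : M.tm.σ) (S : ∀ k, List (M.tm.Γ k)) :
    ∃ r', Frag.skip.Runs (⟨⟨r, t, ok⟩, w, locs l o a b c, S⟩ : State M)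
      ⟨⟨r', t, ok⟩, w, locs (skipOnes l) o a b c, S⟩ (2 * l.length + 1) := by
  induction l generalizing r with
  | nil => exact ⟨none, Frag.runs_loop_false' (by simp [skipOnes]) rfl⟩
  | cons d l ih =>
    cases d with
    | false =>
      exact ⟨some false, (Frag.runs_loop_false' (by simp [skipOnes]) rfl).mono (by omega)⟩
    | true =>
      obtain ⟨r', h⟩ := ih (some true)
      exact ⟨r', (Frag.Runs.loop_true' (Frag.runs_ops []
        (⟨⟨some true, t, ok⟩, w, locs l o a b c, S⟩ : State M)) (by simp) rfl h).mono
        (by simp; omega)⟩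

/-- Reads a self-delimiting list. -/
def Frag.read {M : BinTM} (i : Loc) : Frag M :=
  .loop [popR .inp] (fun v => v.r == some true) (.ops [popR .inp, pushR i])

theorem Frag.runs_read {M : BinTM} {i : Loc} (hi : i ≠ .inp) (v : Reg) (w : M.tm.σ)
    (a : Loc → List Bool) (S : ∀ k, List (M.tm.Γ k)) :
    ∃ r, (Frag.read i).Runs (⟨v, w, a, S⟩ : State M)
      ⟨⟨r, v.s, v.ok⟩, w, update (update a .inp (readList (a i) (a .inp)).2) i
        (readList (a i) (a .inp)).1, S⟩ (2 * (a .inp).length + 1) := by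
  generalize hl : a .inp = l
  generalize hacc : a i = acc
  fun_induction readList acc l generalizing v a with
  | case1 acc b l ih =>
    obtain ⟨r, h⟩ := ih ⟨some b, v.s, v.ok⟩ (update (update a .inp l) i (b :: acc))
      (by simp [hi.symm]) (by simp)
    rw [update_update_update_update hi] at h
    refine ⟨r, ((Frag.runs_ops' (s' := ⟨⟨some b, v.s, v.ok⟩, w,
      update (update a .inp l) i (b :: acc), S⟩) ?_).loop_true'
      (t := ⟨⟨some true, v.s, v.ok⟩, w, update a .inp (b :: l), S⟩) (by simp [hl]) rfl h).mono ?_⟩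
    · simp [hi, hacc]
    · simp; omega
  | case2 acc =>
    refine ⟨none, ((Frag.runs_ops' (s' := ⟨⟨none, v.s, v.ok⟩, w,
      update (update a .inp []) i (false :: acc), S⟩) ?_).loop_true'
      (t := ⟨⟨some true, v.s, v.ok⟩, w, update a .inp [], S⟩) (by simp [hl]) rfl
      (Frag.runs_loop_false' ?_ rfl)).mono (n := 3) (by simp)⟩
    · simp [hi, hacc]
    · have := update_update_update_update hi a [] (false :: acc) [] (false :: acc)
      simp only [opsEval_cons, eval_popR, opsEval_nil]
      congr 1
      · simp [hi.symm]
      · rw [← this]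
        simp [hi.symm]
  | case3 acc l =>
    refine ⟨some false, (Frag.runs_loop_false' ?_ rfl).mono (by omega)⟩
    simp only [opsEval_cons, eval_popR, hl, opsEval_nil, List.head?, List.tail]
    congr 1
    rw [eq_comm, update_eq_self_iff, update_of_ne hi, hacc]
  | case4 acc =>
    refine ⟨none, (Frag.runs_loop_false' ?_ rfl).mono (by omega)⟩
    simp only [opsEval_cons, eval_popR, hl, opsEval_nil, List.head?, List.tail]
    congr 1
    rw [eq_comm, update_eq_self_iff, update_of_ne hi, hacc]

/-- Whether the string `c` is as long as `p` and has ones where `p` has ones. -/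
def dominates : List Bool → List Bool → Bool
  | [], [] => true
  | b :: p, d :: c => (!b || d) && dominates p c
  | _, _ => false

/-- Moves the input to the input stack of the embedded machine and compares it with `Loc.snd`. -/
def Frag.compareInput {M : BinTM} : Frag M :=
  .seq (.each .inp (.ops [popS .snd,
    loadReg fun v => { v with ok := v.ok && v.s.elim false (fun b => !b || v.r.getD false) },
    .mpush M.tm.k₀ fun v => M.inputAlphabet.symm (v.r.getD false)]))
  (.ops [popS .snd, loadReg fun v => { v with ok := v.ok && v.s.isNone }])

theorem Frag.runs_compareInput_loop {M : BinTM} (o a c p l m : List Bool) (r t : Option Bool)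
    (ok : Bool) (w : M.tm.σ) :
    ∃ t' ok' p', (Frag.each .inp (.ops [popS .snd,
      loadReg fun v => { v with ok := v.ok && v.s.elim false (fun b => !b || v.r.getD false) },
      .mpush M.tm.k₀ fun v => M.inputAlphabet.symm (v.r.getD false)])).Runs
      (⟨⟨r, t, ok⟩, w, locs l o a p c, singleStack M.tm.k₀ (m.map M.inputAlphabet.symm)⟩ : State M)
      ⟨⟨none, t', ok'⟩, w, locs [] o a p' c,
        singleStack M.tm.k₀ ((l.reverse ++ m).map M.inputAlphabet.symm)⟩
      (2 * l.length + 1) ∧ p'.length ≤ p.length ∧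
      (ok' && p'.head?.isNone) = (ok && dominates p l) := by
  induction l generalizing r t ok p m with
  | nil =>
    refine ⟨t, ok, p, Frag.runs_loop_false' (by simp) rfl, le_rfl, ?_⟩
    cases p <;> simp [dominates]
  | cons b l ih =>
    obtain ⟨t', ok', p', h, hp, hd⟩ := ih p.tail (b :: m) (some b) p.head?
      (ok && p.head?.elim false (fun d => !d || b))
    refine ⟨t', ok', p', ((Frag.runs_ops' (s' := ⟨⟨some b, p.head?,
      ok && p.head?.elim false (fun d => !d || b)⟩, w, locs l o a p.tail c,
      singleStack M.tm.k₀ ((b :: m).map M.inputAlphabet.symm)⟩) ?_).each_cons rfl h).congr rfl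
      (by simp) (by simp; omega), hp.trans (by simp), ?_⟩
    · simp [singleStack]
    · rw [hd]
      cases p <;> simp [dominates, Bool.and_assoc]

theorem Frag.runs_compareInput {M : BinTM} (o a c p l : List Bool) (v : Reg) (w : M.tm.σ) :
    ∃ t' p', Frag.compareInput.Runs (⟨v, w, locs l o a p c, fun _ => []⟩ : State M)
      ⟨⟨none, t', v.ok && dominates p l⟩, w, locs [] o a p' c,
        singleStack M.tm.k₀ (l.reverse.map M.inputAlphabet.symm)⟩
      (2 * l.length + 2) ∧ p'.length ≤ p.length := by
  obtain ⟨t', ok', p', h, hp, hd⟩ := Frag.runs_compareInput_loop o a c p l [] v.r v.s v.ok w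
  refine ⟨p'.head?, p'.tail, ?_, by simp; omega⟩
  rw [← hd]
  have h0 : singleStack M.tm.k₀ (([] : List Bool).map M.inputAlphabet.symm) = fun _ => [] := by
    simp [singleStack]
  rw [h0, List.append_nil] at h
  refine h.seq (Frag.runs_ops' ?_)
  simp

theorem Frag.runs_move {M : BinTM} (i j : Loc) (hij : i ≠ j) (v : Reg) (w : M.tm.σ)
    (a : Loc → List Bool) (S : ∀ k, List (M.tm.Γ k)) :
    (Frag.each i (.ops [pushR j])).Runs (⟨v, w, a, S⟩ : State M)
      ⟨⟨none, v.s, v.ok⟩, w, update (update a i []) j ((a i).reverse ++ a j), S⟩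
      (2 * (a i).length + 1) := by
  generalize hl : a i = l
  induction l generalizing v a with
  | nil =>
    refine (Frag.runs_each_nil hl).congr rfl ?_ le_rfl
    have : update a i [] = a := by rw [← hl, update_eq_self]
    simp [this]
  | cons b l ih =>
    have h := ih ⟨some b, v.s, v.ok⟩ (update (update a i l) j (b :: a j)) (by simp [hij])
    rw [update_update_update_update hij.symm] at h
    exact ((Frag.runs_ops' (by simp [hij.symm])).each_cons hl h).congr rfl (by simp)
      (by simp; omega)

/-! ### Evaluating polynomials in signed unary notation -/

/-- The number that is represented by a string of signs. -/
def signedCount (l : List Bool) : ℤ := l.count true - l.count false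

theorem signedCount_append (l m : List Bool) :
    signedCount (l ++ m) = signedCount l + signedCount m := by
  simp [signedCount]; ring

theorem signedCount_replicate (n : ℕ) (b : Bool) :
    signedCount (List.replicate n b) = bif b then (n : ℤ) else -n := by
  cases b <;> simp [signedCount, List.count_replicate]

theorem signedCount_reverse (l : List Bool) : signedCount l.reverse = signedCount l := by
  simp [signedCount]

theorem opsEval_replicate_push {M : BinTM} (n : ℕ) (i : Loc) (b : Bool) (s : State M) :
    opsEval (List.replicate n (.push i fun _ => b)) s =
      { s with loc := update s.loc i (List.replicate n b ++ s.loc i) } := by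
  induction n generalizing s with
  | zero => simp
  | succ n ih =>
    rw [List.replicate_succ, opsEval_cons, ih]
    simp [Op.eval, List.replicate_succ']

/-- Pushes a copy of the second register for each element of `Loc.fst`. -/
def Frag.scale {M : BinTM} : Frag M :=
  .seq (.each .fst (.ops [pushR .inp, pushS .out])) (.each .inp (.ops [pushR .fst]))

theorem Frag.runs_scale {M : BinTM} (o x p c : List Bool) (r : Option Bool) (b : Bool) (ok : Bool)
    (w : M.tm.σ) (S : ∀ k, List (M.tm.Γ k)) :
    Frag.scale.Runs (⟨⟨r, some b, ok⟩, w, locs [] o x p c, S⟩ : State M)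
      ⟨⟨none, some b, ok⟩, w, locs [] (List.replicate x.length b ++ o) x p c, S⟩
      (4 * x.length + 2) := by
  have h : ∀ (x i o : List Bool) (r : Option Bool),
      (Frag.each .fst (.ops [pushR .inp, pushS .out])).Runs
        (⟨⟨r, some b, ok⟩, w, locs i o x p c, S⟩ : State M)
        ⟨⟨none, some b, ok⟩, w, locs (x.reverse ++ i) (List.replicate x.length b ++ o) [] p c, S⟩
        (2 * x.length + 1) := by
    intro x
    induction x with
    | nil => exact fun i o r => Frag.runs_each_nil rfl
    | cons d x ih =>
      intro i o r
      exact ((Frag.runs_ops' (by simp)).each_cons rfl (ih (d :: i) (b :: o) (some d))).congr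
        rfl (by simp [List.replicate_succ']) (by simp; omega)
  exact ((h x [] o r).seq (Frag.runs_move .inp .fst (by simp) _ _ _ _)).congr rfl (by simp)
    (by simp; omega)

/-- Multiplies the number on `Loc.thd` by the length of `Loc.fst`. -/
def Frag.mulLength {M : BinTM} : Frag M :=
  .seq (.loop [popS .thd] (fun v => v.s.isSome) .scale) (.each .out (.ops [pushR .thd]))

theorem Frag.exists_runs_mulLength {M : BinTM} (x p c : List Bool) (ok : Bool)
    (w : M.tm.σ) (S : ∀ k, List (M.tm.Γ k)) :
    ∃ c', Frag.mulLength.Runs (⟨⟨none, none, ok⟩, w, locs [] [] x p c, S⟩ : State M)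
      ⟨⟨none, none, ok⟩, w, locs [] [] x p c', S⟩
      (6 * c.length * x.length + 3 * c.length + 2) ∧ c'.length = c.length * x.length ∧
      signedCount c' = signedCount c * x.length := by
  have h : ∀ (c o : List Bool) (t : Option Bool), ∃ o',
      (Frag.loop [popS .thd] (fun v => v.s.isSome) .scale).Runs
        (⟨⟨none, t, ok⟩, w, locs [] o x p c, S⟩ : State M)
        ⟨⟨none, none, ok⟩, w, locs [] (o' ++ o) x p [], S⟩
        (4 * c.length * x.length + 3 * c.length + 1) ∧ o'.length = c.length * x.length ∧
        signedCount o' = signedCount c * x.length := by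
    intro c
    induction c with
    | nil =>
      refine fun o t => ⟨[], (Frag.runs_loop_false' (s' := ⟨⟨none, none, ok⟩, w,
        locs [] o x p [], S⟩) (by simp) rfl).mono (by simp), by simp, by simp [signedCount]⟩
    | cons b c ih =>
      intro o t
      obtain ⟨o', h, hl, hc⟩ := ih (List.replicate x.length b ++ o) (some b)
      refine ⟨o' ++ List.replicate x.length b, ((Frag.runs_scale o x p c none b ok w S).loop_true'
        (s := ⟨⟨none, t, ok⟩, w, locs [] o x p (b :: c), S⟩) (by simp) rfl h).congr rfl
        (by simp) ?_, ?_, ?_⟩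
      · simp only [List.length_cons]; ring_nf; omega
      · simp [hl]; ring
      · rw [← List.singleton_append (x := b), signedCount_append, signedCount_append, hc,
          signedCount_replicate]
        cases b <;> simp [signedCount] <;> ring
  obtain ⟨o', h, hl, hc⟩ := h c [] none
  refine ⟨o'.reverse, (h.seq (Frag.runs_move .out .thd (by simp) _ _ _ _)).congr rfl (by simp) ?_,
    by simp [hl], by rw [signedCount_reverse, hc]⟩
  simp [hl]; ring_nf; omega

theorem monotone_eval_nat (P : Polynomial ℕ) : Monotone fun n => P.eval n := by
  intro m n h
  induction P using Polynomial.induction_on' with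
  | add p q hp hq => simpa using Nat.add_le_add hp hq
  | monomial k a => simpa using Nat.mul_le_mul_left a (Nat.pow_le_pow_left h k)

theorem exists_frag_polynomial (M : BinTM) (q : Polynomial ℤ) :
    ∃ (F : Frag M) (B : Polynomial ℕ), ∀ (x p : List Bool) (ok : Bool) (w : M.tm.σ)
      (S : ∀ k, List (M.tm.Γ k)), ∃ c : List Bool,
      signedCount c = q.eval (x.length : ℤ) ∧ c.length ≤ B.eval x.length ∧
      F.Runs (⟨⟨none, none, ok⟩, w, locs [] [] x p [], S⟩ : State M)
        ⟨⟨none, none, ok⟩, w, locs [] [] x p c, S⟩ (B.eval x.length) := by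
  induction q using Polynomial.recOnHorner with
  | M0 =>
    exact ⟨.ops [], 1, fun x p ok w S => ⟨[], by simp [signedCount], by simp,
      (Frag.runs_ops _ _).congr rfl rfl (by simp)⟩⟩
  | MC q a _ _ ih =>
    obtain ⟨F, B, h⟩ := ih
    refine ⟨F.seq (.ops (List.replicate a.natAbs (.push .thd fun _ => decide (0 ≤ a)))),
      B + Polynomial.C (a.natAbs + 1), fun x p ok w S => ?_⟩
    obtain ⟨c, hc, hl, hr⟩ := h x p ok w S
    refine ⟨List.replicate a.natAbs (decide (0 ≤ a)) ++ c, ?_, ?_,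
      (hr.seq (Frag.runs_ops' ?_)).mono ?_⟩
    · rw [signedCount_append, signedCount_replicate, hc]
      by_cases ha : 0 ≤ a
      · simp [ha, abs_of_nonneg, add_comm]
      · simp [ha, abs_of_neg (not_le.1 ha), add_comm]
    · simp; omega
    · rw [opsEval_replicate_push]; simp
    · simp
  | MX q _ ih =>
    obtain ⟨F, B, h⟩ := ih
    refine ⟨F.seq .mulLength, 6 * B * Polynomial.X + 4 * B + 2, fun x p ok w S => ?_⟩
    obtain ⟨c, hc, hl, hr⟩ := h x p ok w S
    obtain ⟨c', hr', hl', hc'⟩ := Frag.exists_runs_mulLength x p c ok w S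
    have h1 := Nat.mul_le_mul_right x.length hl
    refine ⟨c', by simp [hc', hc], ?_, (hr.seq hr').mono ?_⟩
    · simp; nlinarith
    · simp; nlinarith

/-- Turns the number on `Loc.thd` into the length of `Loc.inp`. -/
def Frag.toUnary {M : BinTM} : Frag M :=
  .seq (.each .thd (.ops [.cpush .inp fun v => v.r == some true,
    .cpush .out fun v => v.r == some false])) (.each .out (.ops [popS .inp]))

theorem Frag.exists_runs_toUnary {M : BinTM} (x p c : List Bool) (v : Reg)
    (w : M.tm.σ) (S : ∀ k, List (M.tm.Γ k)) :
    ∃ t' i, Frag.toUnary.Runs (⟨v, w, locs [] [] x p c, S⟩ : State M)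
      ⟨⟨none, t', v.ok⟩, w, locs i [] x p [], S⟩
      (4 * c.length + 2) ∧ i.length = (signedCount c).toNat := by
  have h1 : ∀ (c i o : List Bool) (v : Reg), ∃ i' o',
      (Frag.each .thd (.ops [.cpush .inp fun v => v.r == some true,
        .cpush .out fun v => v.r == some false])).Runs (⟨v, w, locs i o x p c, S⟩ : State M)
      ⟨⟨none, v.s, v.ok⟩, w, locs i' o' x p [], S⟩ (2 * c.length + 1) ∧
      i'.length = c.count true + i.length ∧ o'.length = c.count false + o.length := by
    intro c
    induction c with
    | nil => exact fun i o v => ⟨i, o, Frag.runs_each_nil rfl, by simp, by simp⟩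
    | cons b c ih =>
      intro i o v
      obtain ⟨i', o', h, hi, ho⟩ := ih (bif b then true :: i else i) (bif b then o else true :: o)
        ⟨some b, v.s, v.ok⟩
      refine ⟨i', o', ((Frag.runs_ops' ?_).each_cons rfl h).mono (by simp; omega), ?_, ?_⟩
      · cases b <;> simp
      · cases b <;> simp [hi]; omega
      · cases b <;> simp [ho]; omega
  have h2 : ∀ (o i : List Bool) (v : Reg), ∃ t',
      (Frag.each .out (.ops [popS .inp])).Runs (⟨v, w, locs i o x p [], S⟩ : State M)
      ⟨⟨none, t', v.ok⟩, w, locs (i.drop o.length) [] x p [], S⟩ (2 * o.length + 1) := by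
    intro o
    induction o with
    | nil => exact fun i v => ⟨v.s, Frag.runs_each_nil rfl⟩
    | cons b o ih =>
      intro i v
      obtain ⟨t', h⟩ := ih i.tail ⟨some b, i.head?, v.ok⟩
      exact ⟨t', ((Frag.runs_ops' (by simp)).each_cons rfl h).congr rfl (by simp)
        (by simp; omega)⟩
  obtain ⟨i', o', h, hi, ho⟩ := h1 c [] [] v
  obtain ⟨t', h'⟩ := h2 o' i' ⟨none, v.s, v.ok⟩
  have := List.count_le_length (a := false) (l := c)
  refine ⟨t', _, (h.seq h').mono ?_, ?_⟩
  · simp at ho; omega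
  · simp [hi, ho, signedCount]

/-! ### Checking and clearing the memory of the embedded machine -/

/-- Pops stacks and clears `ok` if one of them is not empty. -/
def checkEmpty {M : BinTM} (ks : List M.tm.K) : List (Op M) :=
  ks.map fun k => .mpop k fun v o => { v with ok := v.ok && o.isNone }

theorem opsEval_checkEmpty {M : BinTM} (ks : List M.tm.K) (v : Reg) (w : M.tm.σ)
    (a : Loc → List Bool) (S : ∀ k, List (M.tm.Γ k)) :
    ∃ ok S', opsEval (checkEmpty ks) (⟨v, w, a, S⟩ : State M) = ⟨⟨v.r, v.s, ok⟩, w, a, S'⟩ ∧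
      (ok = true ↔ v.ok = true ∧ ∀ k ∈ ks, S k = []) ∧
      (∀ k, (S' k).length ≤ (S k).length) ∧ ∀ k ∉ ks, S' k = S k := by
  induction ks generalizing v S with
  | nil => exact ⟨v.ok, S, rfl, by simp, by simp, by simp⟩
  | cons k ks ih =>
    obtain ⟨ok, S', h1, h2, h3, h4⟩ := ih { v with ok := v.ok && (S k).head?.isNone }
      (update S k (S k).tail)
    refine ⟨ok, S', h1, ?_, fun k' => (h3 k').trans ?_, fun k' hk' => ?_⟩
    · rw [h2]
      cases hk : S k with
      | nil =>
        have : update S k [] = S := by rw [← hk, update_eq_self]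
        simp [hk, this]
      | cons => simp [hk]
    · by_cases h : k' = k
      · subst h; simp
      · simp [h]
    · rw [h4 k' fun h => hk' (List.mem_cons_of_mem _ h), update_of_ne fun h => hk' (by simp [h])]

/-- Pops stacks and sets the first register if one of them was not empty. -/
def popAll {M : BinTM} (ks : List M.tm.K) : List (Op M) :=
  ks.map fun k => .mpop k fun v o => { v with r := if o.isSome then some true else v.r }

theorem opsEval_popAll {M : BinTM} (ks : List M.tm.K) (v : Reg) (w : M.tm.σ)
    (a : Loc → List Bool) (S : ∀ k, List (M.tm.Γ k)) :
    ∃ r S', opsEval (popAll ks) (⟨v, w, a, S⟩ : State M) = ⟨⟨r, v.s, v.ok⟩, w, a, S'⟩ ∧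
      (∀ k, (S' k).length ≤ (S k).length) ∧ (∀ k ∈ ks, (S' k).length ≤ (S k).length - 1) ∧
      (r.isSome = true ↔ v.r.isSome = true ∨ ∃ k ∈ ks, S k ≠ []) := by
  induction ks generalizing v S with
  | nil => exact ⟨v.r, S, rfl, by simp, by simp, by simp⟩
  | cons k ks ih =>
    obtain ⟨r, S', h1, h2, h3, h4⟩ := ih
      { v with r := if (S k).head?.isSome then some true else v.r } (update S k (S k).tail)
    have h5 : ∀ k', (update S k (S k).tail k').length ≤ (S k').length := fun k' => by
      by_cases h : k' = k
      · subst h; simp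
      · simp [h]
    refine ⟨r, S', h1, fun k' => (h2 k').trans (h5 k'), fun k' hk' => ?_, ?_⟩
    · by_cases h : k' = k
      · subst h; simpa using h2 k'
      · exact (h3 k' ((List.mem_cons.1 hk').resolve_left h)).trans
          (Nat.sub_le_sub_right (h5 k') 1)
    · rw [h4]
      cases hk : S k with
      | nil =>
        have : update S k [] = S := by rw [← hk, update_eq_self]
        simp [hk, this]
      | cons => simp [hk]

/-- All stacks of the embedded machine. -/
noncomputable def allStacks (M : BinTM) : List M.tm.K :=
  (@Finset.univ _ M.tm.kFin).toList

theorem mem_allStacks {M : BinTM} (k : M.tm.K) : k ∈ allStacks M := by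
  simp [allStacks]

/-- Empties the stacks of the embedded machine. -/
noncomputable def Frag.clearMem {M : BinTM} : Frag M :=
  .loop (loadReg (fun v => { v with r := none }) :: popAll (allStacks M)) (fun v => v.r.isSome)
    (.ops [])

theorem Frag.runs_clearMem {M : BinTM} (N : ℕ) (v : Reg) (w : M.tm.σ) (a : Loc → List Bool)
    (S : ∀ k, List (M.tm.Γ k)) (h : ∀ k, (S k).length ≤ N) :
    Frag.clearMem.Runs (⟨v, w, a, S⟩ : State M) ⟨⟨none, v.s, v.ok⟩, w, a, fun _ => []⟩
      (2 * N + 1) := by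
  induction N generalizing v S with
  | zero =>
    obtain ⟨r, S', h1, h2, h3, h4⟩ := opsEval_popAll (allStacks M) ⟨none, v.s, v.ok⟩ w a S
    have hS : ∀ k, S k = [] := fun k => List.length_eq_zero_iff.1 (Nat.le_zero.1 (h k))
    have hr : r = none := by simpa [hS] using h4
    have hS' : S' = fun _ => [] := by
      funext k; simpa [hS] using h2 k
    exact Frag.runs_loop_false' (by simp [h1, hr, hS']) rfl
  | succ N ih =>
    obtain ⟨r, S', h1, h2, h3, h4⟩ := opsEval_popAll (allStacks M) ⟨none, v.s, v.ok⟩ w a S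
    cases r with
    | none =>
      have hS : ∀ k, S k = [] := by simpa [mem_allStacks] using h4
      have hS' : S' = fun _ => [] := by
        funext k; simpa [hS] using h2 k
      exact (Frag.runs_loop_false' (by simp [h1, hS']) rfl).mono (by omega)
    | some b =>
      exact ((Frag.runs_ops [] _).loop_true' (t := ⟨⟨some b, v.s, v.ok⟩, w, a, S'⟩)
        (by simp [h1]) rfl (ih ⟨some b, v.s, v.ok⟩ S' fun k =>
          (h3 k (mem_allStacks k)).trans (by have := h k; omega))).mono (by omega)

open Classical in
/-- Clears `ok` unless the embedded machine is in its initial state, with all stacks empty except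
for the output stack. -/
noncomputable def checkRest (M : BinTM) : List (Op M) :=
  .load (fun v w => ({ v with ok := v.ok && decide (w = M.tm.initialState) },
    M.tm.initialState)) :: checkEmpty ((allStacks M).filter fun k => k ≠ M.tm.k₁)

/-- Compares the output of the embedded machine with `Loc.fst`. -/
def Frag.compareOutput {M : BinTM} : Frag M :=
  .seq (.each .fst (.ops [.mpop M.tm.k₁ fun v o =>
    { v with ok := v.ok && o.map M.outputAlphabet == v.r }]))
  (.ops [.mpop M.tm.k₁ fun v o => { v with ok := v.ok && o.isNone }])

theorem Frag.exists_runs_compareOutput {M : BinTM} (i o x p c : List Bool) (v : Reg) (w : M.tm.σ)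
    (S : ∀ k, List (M.tm.Γ k)) :
    ∃ ok S', Frag.compareOutput.Runs (⟨v, w, locs i o x p c, S⟩ : State M)
      ⟨⟨none, v.s, ok⟩, w, locs i o [] p c, S'⟩ (2 * x.length + 2) ∧
      (ok = true ↔ v.ok = true ∧ (S M.tm.k₁).map M.outputAlphabet = x) ∧
      ∀ k, (S' k).length ≤ (S k).length := by
  have hS : ∀ (S : ∀ k, List (M.tm.Γ k)) (k),
      (update S M.tm.k₁ (S M.tm.k₁).tail k).length ≤ (S k).length := fun S k => by
    by_cases h : k = M.tm.k₁
    · subst h; simp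
    · simp [h]
  have h : ∀ (x : List Bool) (v : Reg) (S : ∀ k, List (M.tm.Γ k)), ∃ ok S',
      (Frag.each .fst (.ops [.mpop M.tm.k₁ fun v o =>
        { v with ok := v.ok && o.map M.outputAlphabet == v.r }])).Runs
        (⟨v, w, locs i o x p c, S⟩ : State M)
        ⟨⟨none, v.s, ok⟩, w, locs i o [] p c, S'⟩ (2 * x.length + 1) ∧
      (ok = true ∧ S' M.tm.k₁ = [] ↔ v.ok = true ∧ (S M.tm.k₁).map M.outputAlphabet = x) ∧
      ∀ k, (S' k).length ≤ (S k).length := by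
    intro x
    induction x with
    | nil => exact fun v S => ⟨v.ok, S, Frag.runs_each_nil rfl, by simp, by simp⟩
    | cons b x ih =>
      intro v S
      obtain ⟨ok, S', h1, h2, h3⟩ := ih ⟨some b, v.s,
        v.ok && (S M.tm.k₁).head?.map M.outputAlphabet == some b⟩
        (update S M.tm.k₁ (S M.tm.k₁).tail)
      refine ⟨ok, S', ((Frag.runs_ops' (by simp)).each_cons rfl h1).mono (by simp; omega), ?_,
        fun k => (h3 k).trans (hS S k)⟩
      rw [h2]
      cases S M.tm.k₁ <;> simp [and_assoc]
  obtain ⟨ok, S', h1, h2, h3⟩ := h x v S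
  refine ⟨ok && (S' M.tm.k₁).head?.isNone, _, h1.seq (Frag.runs_ops' (by simp)), ?_,
    fun k => (hS S' k).trans (h3 k)⟩
  rw [← h2]
  simp

theorem exists_integer_bound (p : Polynomial ℚ) : ∃ (D : ℕ) (q : Polynomial ℤ), 0 < D ∧
    ∀ n k : ℕ, (k : ℚ) ≤ polyBound p n ↔ ((D * k : ℕ) : ℤ) ≤ q.eval (n : ℤ) := by
  obtain ⟨b, hbM, hb⟩ := IsLocalization.integerNormalization_spec (nonZeroDivisors ℤ) p
  have hb0 : b ≠ 0 := nonZeroDivisors.ne_zero hbM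
  generalize IsLocalization.integerNormalization (nonZeroDivisors ℤ) p = q at hb
  refine ⟨b.natAbs, Polynomial.C b.sign * q, Int.natAbs_pos.2 hb0, fun n k => ?_⟩
  have h : ((q.eval (n : ℤ) : ℤ) : ℚ) = b * p.eval (n : ℚ) := by
    have := congrArg (Polynomial.eval (n : ℚ)) hb
    rw [Polynomial.eval_smul, zsmul_eq_mul] at this
    rw [← this, ← Int.cast_natCast (R := ℚ) n]
    exact (Polynomial.eval_intCast_map (algebraMap ℤ ℚ) q n).symm
  rw [← Int.cast_le (R := ℚ), Polynomial.eval_mul, Polynomial.eval_C, Int.cast_mul, h, ← mul_assoc,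
    ← Int.cast_mul, Int.sign_mul_self_eq_abs, Nat.cast_mul, Int.natCast_natAbs, Int.cast_mul,
    mul_le_mul_iff_right₀ (by exact_mod_cast abs_pos.2 hb0)]
  simp [polyBound]

theorem toNat_signedCount_le (l : List Bool) : (signedCount l).toNat ≤ l.length := by
  have := List.count_le_length (a := true) (l := l)
  unfold signedCount
  omega

/-- The strings that the verifier accepts. They consist of a prefix that ends with the first `false`,
the codes of two lists, and a reversed program. -/
def Accepts (U : BinTM) (p : Polynomial ℚ) (z : List Bool) : Prop :=
  dominates (readList [] (readList [] (skipOnes z)).2).1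
    (readList [] (readList [] (skipOnes z)).2).2 = true ∧
  OutputsWithin U (readList [] (readList [] (skipOnes z)).2).2.reverse
    (readList [] (skipOnes z)).1 (polyBound p (readList [] (skipOnes z)).1.length)

theorem exists_frag_accepts (U : BinTM) (p : Polynomial ℚ) :
    ∃ (F : Frag U) (Q : Polynomial ℕ), ∀ z, ∃ ok : Bool, (ok = true ↔ Accepts U p z) ∧
      F.Runs (State.rest (singleStack .inp z)) (State.rest (singleStack .out [ok]))
        (Q.eval z.length) := by
  obtain ⟨D, q, hD, hq⟩ := exists_integer_bound p
  obtain ⟨C, hC⟩ := exists_opCount_le U.tm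
  obtain ⟨H, B, hH⟩ := exists_frag_polynomial U q
  refine ⟨.seq .skip <| .seq (.read .fst) <| .seq (.read .snd) <| .seq .compareInput <|
    .seq (.ops [loadReg fun v => { v with s := none }]) <| .seq H <| .seq .toUnary <|
    .seq (.clocked .inp D) <| .seq (.ops (checkRest U)) <| .seq .compareOutput <|
    .seq .clearMem <| .seq (.clear .inp) <| .seq (.clear .snd) <|
    .ops [.push .out fun v => v.ok, loadReg fun _ => Reg.init],
    20 * Polynomial.X + Polynomial.C (10 + 2 * C) * B + Polynomial.C (2 * C + 30), fun z => ?_⟩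
  have hz1 := skipOnes_length z
  have hz2 := readList_length [] (skipOnes z)
  have hz3 := readList_length [] (readList [] (skipOnes z)).2
  simp only [List.length_nil, zero_add] at hz2 hz3
  unfold Accepts
  obtain ⟨r1, h1⟩ := Frag.runs_skip (M := U) z [] [] [] [] none none true U.tm.initialState
    fun _ => []
  obtain ⟨r2, h2⟩ := Frag.runs_read (M := U) (i := .fst) (by simp) ⟨r1, none, true⟩
    U.tm.initialState (locs (skipOnes z) [] [] [] []) fun _ => []
  simp only [locs_fst, locs_inp, update_locs_inp, update_locs_fst] at h2
  generalize (readList [] (skipOnes z)).1 = x at *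
  generalize (readList [] (skipOnes z)).2 = z' at *
  obtain ⟨r3, h3⟩ := Frag.runs_read (M := U) (i := .snd) (by simp) ⟨r2, none, true⟩
    U.tm.initialState (locs z' [] x [] []) fun _ => []
  simp only [locs_snd, locs_inp, update_locs_inp, update_locs_snd] at h3
  generalize (readList [] z').1 = y at *
  generalize (readList [] z').2 = c at *
  obtain ⟨t4, y', h4, hy⟩ := Frag.runs_compareInput (M := U) [] x [] y c ⟨r3, none, true⟩
    U.tm.initialState
  simp only [Bool.true_and] at h4
  generalize dominates y c = dom at *
  obtain ⟨m, hm, hmB, h6⟩ := hH x y' dom U.tm.initialState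
    (singleStack U.tm.k₀ (c.reverse.map U.inputAlphabet.symm))
  obtain ⟨t7, i, h7, hi⟩ := Frag.exists_runs_toUnary (M := U) x y' m ⟨none, none, dom⟩
    U.tm.initialState (singleStack U.tm.k₀ (c.reverse.map U.inputAlphabet.symm))
  obtain ⟨⟨v8, w8, a8, S8⟩, h8, hS8, hv8, ⟨n, ha8⟩, hok8, hst8⟩ :=
    Frag.exists_runsFrom_clocked .inp hD hC i.length U.tm.main
    ⟨⟨none, t7, dom⟩, U.tm.initialState, locs i [] x y' [],
      singleStack U.tm.k₀ (c.reverse.map U.inputAlphabet.symm)⟩ rfl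
  simp only [locs_inp, update_locs_inp] at ha8 hv8 hok8 hS8 hst8
  subst ha8
  rw [hv8] at h8
  classical
  obtain ⟨ok9, S9, h9, hok9, hS9, hSk9⟩ := opsEval_checkEmpty (M := U)
    ((allStacks U).filter fun k => k ≠ U.tm.k₁)
    ⟨none, t7, v8.ok && decide (w8 = U.tm.initialState)⟩ U.tm.initialState
    (locs (i.drop n) [] x y' []) S8
  obtain ⟨ok10, S10, h10, hok10, hS10⟩ := Frag.exists_runs_compareOutput (M := U) (i.drop n) [] x y'
    [] ⟨none, t7, ok9⟩ U.tm.initialState S9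
  have hc : ∀ k, (S10 k).length ≤ z.length + C * (B.eval x.length + 1) := fun k => by
    have h1 := ((hS10 k).trans (hS9 k)).trans (hS8 k)
    have h2 : (singleStack U.tm.k₀ (c.reverse.map U.inputAlphabet.symm) k).length ≤ c.length := by
      by_cases h : k = U.tm.k₀
      · subst h; simp [singleStack]
      · simp [singleStack, h]
    have h3 := toNat_signedCount_le m
    have h4 : C * (i.length + 1) ≤ C * (B.eval x.length + 1) :=
      Nat.mul_le_mul_left _ (by omega)
    omega
  have h11 := Frag.runs_clearMem (M := U) _ ⟨none, t7, ok10⟩ U.tm.initialState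
    (locs (i.drop n) [] [] y' []) S10 hc
  have h12 := Frag.runs_clear (M := U) .inp ⟨none, t7, ok10⟩ U.tm.initialState
    (locs (i.drop n) [] [] y' []) fun _ => []
  have h13 := Frag.runs_clear (M := U) .snd ⟨none, t7, ok10⟩ U.tm.initialState
    (locs [] [] [] y' []) fun _ => []
  simp only [locs_inp, update_locs_inp, locs_snd, update_locs_snd] at h12 h13
  refine ⟨ok10, ?_, ?_⟩
  · rw [hok10, hok9, hSk9 _ (by simp), outputsWithin_iff]
    simp only [Bool.and_eq_true, decide_eq_true_eq, List.mem_filter, mem_allStacks, true_and]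
    constructor
    · rintro ⟨⟨⟨hv, rfl⟩, hS⟩, hx⟩
      obtain ⟨hdom, j, v, S, hj, hst⟩ := hok8.1 hv
      obtain ⟨j', hst'⟩ := hst8 hv
      obtain ⟨rfl, he⟩ := hst.unique rfl hst' rfl
      refine ⟨hdom, j, ?_, ?_⟩
      · rw [hq]
        cases j with
        | zero => simp [StepsTo] at hst
        | succ j =>
          have : 0 < D * (j + 1) := by positivity
          omega
      · convert hst'
        subst hx
        funext k
        by_cases h : k = U.tm.k₁
        · subst h; simp [singleStack]
        · simp [singleStack, h, hS]
    · rintro ⟨hdom, j, hj, hst⟩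
      rw [hq] at hj
      have hv := hok8.2 ⟨hdom, j, _, _, by omega, hst⟩
      obtain ⟨j', hst'⟩ := hst8 hv
      obtain ⟨-, he⟩ := hst.unique rfl hst' rfl
      simp only [TM2.Cfg.mk.injEq, true_and] at he
      obtain ⟨rfl, rfl⟩ := he
      refine ⟨⟨⟨hv, rfl⟩, fun k hk => ?_⟩, ?_⟩
      · simp [singleStack, hk]
      · simp [singleStack]
  · rw [singleStack_inp, singleStack_out]
    have hB := monotone_eval_nat B (show x.length ≤ z.length by omega)
    have h3' := toNat_signedCount_le m
    refine (h1.seq <| h2.seq <| h3.seq <| h4.seq <| (Frag.runs_ops' ?_).seq <| h6.seq <|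
      h7.seq <| Frag.Runs.seq h8 <| (Frag.runs_ops' ?_).seq <| h10.seq <| h11.seq <| h12.seq <|
      h13.seq <| Frag.runs_ops' ?_).mono ?_
    · simp
    · unfold checkRest
      exact h9
    · simp [State.rest]
    · simp only [List.length_drop, Polynomial.eval_add, Polynomial.eval_mul,
        Polynomial.eval_C, Polynomial.eval_X, Polynomial.eval_ofNat] at *
      have h4' : C * (B.eval x.length + 1) ≤ C * B.eval z.length + C :=
        Nat.mul_le_mul_left C (Nat.succ_le_succ hB)
      rw [add_mul, mul_assoc]
      omega

/-- The language of the strings that the verifier accepts. -/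
def acceptLanguage (U : BinTM) (p : Polynomial ℚ) : Language Bool := {z | Accepts U p z}

theorem acceptLanguage_mem_classP (U : BinTM) (p : Polynomial ℚ) :
    acceptLanguage U p ∈ ClassP := by
  obtain ⟨F, Q, h⟩ := exists_frag_accepts U p
  refine ⟨⟨F.machine, Q + 1, fun z => Classical.choice ?_⟩⟩
  obtain ⟨ok, hok, h⟩ := h z
  have he : ∀ inst : Decidable (z ∈ acceptLanguage U p), @decide _ inst = ok := fun inst => by
    have : z ∈ acceptLanguage U p ↔ ok = true := hok.symm
    cases ok <;> simp [this]
  rw [he, Polynomial.eval_add, Polynomial.eval_one]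
  exact h.machine_outputs

/-- The language of the strings that have a continuation that the verifier accepts. -/
def searchLanguage (U : BinTM) (p : Polynomial ℚ) : Language Bool :=
  {z | ∃ w : List Bool, w.length ≤ z.length ∧ pair z w ∈ acceptLanguage U p}

theorem searchLanguage_mem_classNP (U : BinTM) (p : Polynomial ℚ) :
    searchLanguage U p ∈ ClassNP :=
  ⟨Polynomial.X, acceptLanguage U p, acceptLanguage_mem_classP U p, fun z => by
    rw [Polynomial.eval_X]; rfl⟩

theorem dominates_length {l c : List Bool} (h : dominates l c = true) : l.length = c.length := by
  fun_induction dominates l c <;> simp_all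

theorem mem_searchLanguage_iff (U : BinTM) (p : Polynomial ℚ) (x l : List Bool) :
    encodeList x.reverse ++ encodeList l.reverse ∈ searchLanguage U p ↔
      ∃ c, dominates l c = true ∧ OutputsWithin U c.reverse x (polyBound p x.length) := by
  have h : ∀ c, pair (encodeList x.reverse ++ encodeList l.reverse) c ∈ acceptLanguage U p ↔
      dominates l c = true ∧ OutputsWithin U c.reverse x (polyBound p x.length) := fun c => by
    change Accepts _ _ _ ↔ _
    unfold Accepts pair
    rw [skipOnes_replicate, List.append_assoc, readList_encodeList]
    simp only [readList_encodeList, List.reverse_reverse, List.append_nil]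
  change (∃ c, _ ∧ _) ↔ _
  refine exists_congr fun c => ?_
  rw [h, and_iff_right_iff_imp]
  rintro ⟨hd, -⟩
  have := dominates_length hd
  simp [length_encodeList]
  omega

/-- The embedded machine decides `A` within the time bound `T`. -/
def Decides (M : BinTM) (A : List Bool → Bool) (T : Polynomial ℕ) : Prop :=
  ∀ z, ∃ j ≤ T.eval z.length, StepsTo (TM2.step M.tm.m) j
    ⟨some M.tm.main, M.tm.initialState, singleStack M.tm.k₀ (z.map M.inputAlphabet.symm)⟩
    ⟨none, M.tm.initialState, singleStack M.tm.k₁ ([A z].map M.outputAlphabet.symm)⟩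

/-- Pushes a bit on the input stack of the embedded machine. -/
def pushInput {M : BinTM} (f : Reg → Bool) : Op M :=
  .mpush M.tm.k₀ fun v => M.inputAlphabet.symm (f v)

theorem eval_pushInput {M : BinTM} (f : Reg → Bool) (v : Reg) (w : M.tm.σ) (a : Loc → List Bool)
    (m : List Bool) : (pushInput f).eval
      (⟨v, w, a, singleStack M.tm.k₀ (m.map M.inputAlphabet.symm)⟩ : State M) =
        ⟨v, w, a, singleStack M.tm.k₀ ((f v :: m).map M.inputAlphabet.symm)⟩ := by
  simp [pushInput, singleStack]

/-- Adds the contents of a stack to the self-delimiting code that begins on the input stack of the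
embedded machine. -/
def Frag.emit {M : BinTM} (i : Loc) : Frag M :=
  .seq (.each i (.ops [pushR .fst, pushInput fun v => v.r.getD false, pushInput fun _ => true]))
    (.each .fst (.ops [pushR i]))

theorem Frag.runs_emit {M : BinTM} {i : Loc} (hi : i ≠ .fst) (v : Reg) (w : M.tm.σ)
    (a : Loc → List Bool) (ha : a .fst = []) (m r : List Bool) :
    (Frag.emit i).Runs
      (⟨v, w, a, singleStack M.tm.k₀ ((encodeList m ++ r).map M.inputAlphabet.symm)⟩ : State M)
      ⟨⟨none, v.s, v.ok⟩, w, a, singleStack M.tm.k₀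
        ((encodeList ((a i).reverse ++ m) ++ r).map M.inputAlphabet.symm)⟩
      (4 * (a i).length + 2) := by
  have h : ∀ (l m t : List Bool) (v : Reg),
      (Frag.each i (.ops [pushR .fst, pushInput fun v => v.r.getD false,
        pushInput fun _ => true])).Runs
      (⟨v, w, update (update a .fst t) i l,
        singleStack M.tm.k₀ ((encodeList m ++ r).map M.inputAlphabet.symm)⟩ : State M)
      ⟨⟨none, v.s, v.ok⟩, w, update (update a .fst (l.reverse ++ t)) i [], singleStack M.tm.k₀
        ((encodeList (l.reverse ++ m) ++ r).map M.inputAlphabet.symm)⟩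
      (2 * l.length + 1) := by
    intro l
    induction l with
    | nil => exact fun m t v => Frag.runs_each_nil (by simp)
    | cons b l ih =>
      intro m t v
      refine ((Frag.runs_ops' (s' := ⟨⟨some b, v.s, v.ok⟩, w, update (update a .fst (b :: t)) i l,
        singleStack M.tm.k₀ ((encodeList (b :: m) ++ r).map M.inputAlphabet.symm)⟩)
        ?_).each_cons (l := l) (b := b) (by simp) (ih (b :: m) (b :: t) ⟨some b, v.s, v.ok⟩)).congr
        rfl (by simp) (by simp; omega)
      simp only [opsEval_cons, opsEval_nil, eval_pushR, eval_pushInput]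
      simp [hi.symm, encodeList, update_comm hi]
  have h1 := h (a i) m [] v
  have h0 : update (update a .fst []) i (a i) = a := by
    rw [← ha, update_eq_self, update_eq_self]
  rw [h0] at h1
  refine (h1.seq (Frag.runs_move .fst i hi.symm _ _ _ _)).congr rfl ?_ ?_
  · congr 1
    rw [update_update_update_update hi]
    simpa [hi.symm] using h0
  · simp [hi.symm]; omega

/-- Asks the embedded machine about the code of the input and of the joined contents of the last two
stacks. -/
def Frag.query {M : BinTM} : Frag M :=
  .seq (.ops [pushInput fun _ => false]) <| .seq (.emit .snd) <| .seq (.emit .thd) <|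
  .seq (.ops [pushInput fun _ => false]) <| .seq (.emit .inp) <| .seq (.clocked .inp 0) <|
  .ops [.mpop M.tm.k₁ fun v o => { v with r := o.map M.outputAlphabet }]

/-- A bound for the time that a query takes. -/
noncomputable def queryTime (T : Polynomial ℕ) : Polynomial ℕ :=
  4 * Polynomial.X + 9 + T.comp (2 * Polynomial.X + 2)

theorem Frag.runs_query {M : BinTM} {A : List Bool → Bool} {T : Polynomial ℕ} (hM : Decides M A T)
    (x l d : List Bool) (r : Option Bool) :
    Frag.query.Runs
      (⟨⟨r, none, true⟩, M.tm.initialState, locs x [] [] l d, fun _ => []⟩ : State M)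
      ⟨⟨some (A (encodeList x.reverse ++ encodeList (l ++ d).reverse)), none, true⟩,
        M.tm.initialState, locs x [] [] l d, fun _ => []⟩
      ((queryTime T).eval (x.length + l.length + d.length)) := by
  obtain ⟨j, hj, h⟩ := hM (encodeList x.reverse ++ encodeList (l ++ d).reverse)
  generalize A _ = b at *
  have h0 : (fun _ => [] : ∀ k, List (M.tm.Γ k)) =
      singleStack M.tm.k₀ (([] : List Bool).map M.inputAlphabet.symm) := by
    simp [singleStack]
  have h1 := Frag.runs_ops (M := M) [pushInput fun _ => false]
    ⟨⟨r, none, true⟩, M.tm.initialState, locs x [] [] l d, fun _ => []⟩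
  rw [h0, opsEval_cons, opsEval_nil, eval_pushInput] at h1
  have h2 := Frag.runs_emit (M := M) (i := .snd) (by simp) ⟨r, none, true⟩ M.tm.initialState
    (locs x [] [] l d) rfl [] []
  have h3 := Frag.runs_emit (M := M) (i := .thd) (by simp) ⟨none, none, true⟩ M.tm.initialState
    (locs x [] [] l d) rfl l.reverse []
  simp only [locs_snd, locs_thd, List.append_nil, ← List.reverse_append] at h2 h3
  have h4 := Frag.runs_ops (M := M) [pushInput fun _ => false] ⟨⟨none, none, true⟩,
    M.tm.initialState, locs x [] [] l d, singleStack M.tm.k₀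
      ((encodeList (l ++ d).reverse).map M.inputAlphabet.symm)⟩
  rw [opsEval_cons, opsEval_nil, eval_pushInput] at h4
  have h5 := Frag.runs_emit (M := M) (i := .inp) (by simp) ⟨none, none, true⟩ M.tm.initialState
    (locs x [] [] l d) rfl [] (encodeList (l ++ d).reverse)
  simp only [locs_inp, List.append_nil] at h5
  have h6 := Frag.runsFrom_unclocked (M := M) .inp (s := ⟨⟨none, none, true⟩, M.tm.initialState,
    locs x [] [] l d, _⟩) rfl h
  rw [← h0] at h1
  refine (h1.seq <| h2.seq <| h3.seq <| h4.seq <| h5.seq <| Frag.Runs.seq h6 <|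
    Frag.runs_ops' ?_).mono ?_
  · simp [singleStack]
  · have hl : (encodeList x.reverse ++ encodeList (l ++ d).reverse).length =
        2 * (x.length + l.length + d.length) + 2 := by
      simp [length_encodeList]; ring
    rw [hl] at hj
    simp [queryTime]
    omega

/-- Pushes zeros on `Loc.snd` until the answer to the query is positive. -/
def Frag.findLength {M : BinTM} : Frag M :=
  .seq .query (.loop [] (fun v => v.r == some false) (.seq (.ops [.push .snd fun _ => false]) .query))

theorem Frag.runs_findLength {M : BinTM} {A : List Bool → Bool} {T : Polynomial ℕ}
    (hM : Decides M A T) (x : List Bool) {n : ℕ}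
    (hn : A (encodeList x.reverse ++ encodeList (List.replicate n false).reverse) = true)
    (hlt : ∀ m < n,
      A (encodeList x.reverse ++ encodeList (List.replicate m false).reverse) = false) :
    Frag.findLength.Runs
      (⟨⟨none, none, true⟩, M.tm.initialState, locs x [] [] [] [], fun _ => []⟩ : State M)
      ⟨⟨some true, none, true⟩, M.tm.initialState, locs x [] [] (List.replicate n false) [],
        fun _ => []⟩
      ((n + 1) * ((queryTime T).eval (x.length + n) + 2)) := by
  have h : ∀ k m, m + k = n →
      (Frag.loop [] (fun v => v.r == some false)
        (.seq (.ops [.push .snd fun _ => false]) .query)).Runs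
      (⟨⟨some (A (encodeList x.reverse ++ encodeList (List.replicate m false).reverse)), none,
        true⟩, M.tm.initialState, locs x [] [] (List.replicate m false) [], fun _ => []⟩ : State M)
      ⟨⟨some true, none, true⟩, M.tm.initialState, locs x [] [] (List.replicate n false) [],
        fun _ => []⟩ (k * ((queryTime T).eval (x.length + n) + 2) + 1) := by
    intro k
    induction k with
    | zero =>
      rintro m rfl
      exact (Frag.runs_loop_false' (by simp only [Nat.add_zero] at hn; rw [hn]; rfl) rfl).mono
        (by simp)
    | succ k ih =>
      intro m hm
      have h1 := Frag.runs_query hM x (List.replicate (m + 1) false) [] (some false)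
      rw [List.append_nil] at h1
      have hT := monotone_eval_nat (queryTime T) (show x.length + (m + 1) ≤ x.length + n by omega)
      rw [hlt m (by omega)]
      refine (((Frag.runs_ops' ?_).seq h1).loop_true' rfl rfl
        (ih (m + 1) (by omega))).mono ?_
      · simp [List.replicate_succ]
      · simp at hT ⊢
        rw [Nat.succ_mul]
        omega
  have h1 := Frag.runs_query hM x [] [] none
  have hT := monotone_eval_nat (queryTime T) (show x.length ≤ x.length + n by omega)
  refine (h1.seq (h n 0 (by simp))).mono ?_
  simp at hT ⊢
  rw [Nat.succ_mul]
  omega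

/-- Moves the elements of `Loc.snd` to `Loc.thd` and turns them into ones if the answer to the query
then is positive. -/
def Frag.findBits {M : BinTM} : Frag M :=
  .each .snd (.seq (.ops [.push .thd fun _ => true]) (.seq .query
    (.ops [.pop .thd fun v _ => v, .push .thd fun v => v.r == some true])))

theorem dominates_replicate_append (k : ℕ) (l c : List Bool) :
    dominates (List.replicate k false ++ l) c = true ↔
      k ≤ c.length ∧ dominates l (c.drop k) = true := by
  induction k generalizing c with
  | zero => simp
  | succ k ih => cases c <;> simp [List.replicate_succ, dominates, ih]

theorem Frag.runs_findBits {M : BinTM} {A : List Bool → Bool} {T : Polynomial ℕ}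
    (hM : Decides M A T) {x : List Bool} {Good : List Bool → Prop}
    (hA : ∀ l, A (encodeList x.reverse ++ encodeList l.reverse) = true ↔
      ∃ c, dominates l c = true ∧ Good c) (k : ℕ) (d : List Bool) (r : Option Bool)
    (hd : ∃ c, dominates (List.replicate k false ++ d) c = true ∧ Good c)
    (hdrop : ∀ c, dominates (List.replicate k false ++ d) c = true → Good c → c.drop k = d) :
    ∃ d', d'.length = k + d.length ∧ Good d' ∧ Frag.findBits.Runs
      (⟨⟨r, none, true⟩, M.tm.initialState, locs x [] [] (List.replicate k false) d,
        fun _ => []⟩ : State M)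
      ⟨⟨none, none, true⟩, M.tm.initialState, locs x [] [] [] d', fun _ => []⟩
      (k * ((queryTime T).eval (x.length + k + d.length) + 3) + 1) := by
  induction k generalizing d r with
  | zero =>
    obtain ⟨c, hc, hg⟩ := hd
    obtain rfl : c = d := by simpa using hdrop c hc hg
    exact ⟨c, by simp, hg, (Frag.runs_each_nil rfl).mono (by simp)⟩
  | succ k ih =>
    have hsucc : ∀ b c, dominates (List.replicate k false ++ b :: d) c = true →
        dominates (List.replicate (k + 1) false ++ d) c = true ∧
        ∃ e, c.drop k = e :: c.drop (k + 1) ∧ (b = true → e = true) := by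
      intro b c h
      rw [dominates_replicate_append] at h ⊢
      obtain ⟨hk, h⟩ := h
      cases hc : c.drop k with
      | nil => simp [hc, dominates] at h
      | cons e c' =>
        have hk' : k < c.length := by
          by_contra hk'
          rw [List.drop_eq_nil_of_le (by omega)] at hc
          simp at hc
        have hc' : c.drop (k + 1) = c' := by rw [← List.drop_drop, hc]; rfl
        simp only [hc, dominates, Bool.and_eq_true, Bool.or_eq_true] at h
        exact ⟨⟨hk', hc' ▸ h.2⟩, e, by rw [hc'], fun hb => by simpa [hb] using h.1⟩
    have hA' := hA (List.replicate k false ++ true :: d)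
    have h1 := Frag.runs_query hM x (List.replicate k false) (true :: d) (some false)
    generalize hb : A _ = b at hA' h1
    obtain ⟨d', hl, hg, h⟩ := ih (b :: d) (some b) (by
      cases b with
      | true => exact hA'.1 rfl
      | false =>
        obtain ⟨c, hc, hg⟩ := hd
        refine ⟨c, ?_, hg⟩
        convert hc using 1
        simp [List.replicate_succ']) (by
      intro c hc hg
      obtain ⟨hc', e, he, hbe⟩ := hsucc b c hc
      rw [hdrop c hc' hg] at he
      cases b with
      | true => rw [he, hbe rfl]
      | false =>
        cases e with
        | false => exact he
        | true =>
          refine absurd (hA'.2 ⟨c, ?_, hg⟩) (by simp)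
          rw [dominates_replicate_append] at hc ⊢
          rw [he] at hc ⊢
          simpa [dominates] using hc)
    refine ⟨d', by simp [hl]; omega, hg, (((Frag.runs_ops' ?_).seq (h1.seq
      (Frag.runs_ops' ?_))).each_cons (b := false) (l := List.replicate k false) rfl h).mono ?_⟩
    · simp
    · simp
    · simp only [List.length_replicate, List.length_cons]
      rw [Nat.succ_mul, show x.length + (k + 1) + d.length = x.length + k + (d.length + 1) by ring]
      omega

/-- Finds the length of a shortest program, then its bits. -/
def Frag.search {M : BinTM} : Frag M :=
  .seq .findLength <| .seq .findBits <| .seq (.each .thd (.ops [pushR .out])) <|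
  .seq (.clear .inp) (.ops [loadReg fun _ => Reg.init])

theorem Frag.exists_runs_search {M : BinTM} {A : List Bool → Bool} {T : Polynomial ℕ}
    (hM : Decides M A T) {x : List Bool} {Good : List Bool → Prop}
    (hA : ∀ l, A (encodeList x.reverse ++ encodeList l.reverse) = true ↔
      ∃ c, dominates l c = true ∧ Good c.reverse) {N : ℕ} (hN : ∃ c, Good c ∧ c.length ≤ N) :
    ∃ d, Good d ∧ (∀ c, Good c → d.length ≤ c.length) ∧ Frag.search.Runs
      (State.rest (M := M) (singleStack .inp x)) (State.rest (singleStack .out d))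
      ((N + 1) * ((queryTime T).eval (x.length + N) + 2) +
        N * ((queryTime T).eval (x.length + N) + 3) + 2 * N + 2 * x.length + 4) := by
  classical
  have hdom : ∀ n c, dominates (List.replicate n false) c = true ↔ n = c.length := by
    intro n c
    have := dominates_replicate_append n [] c
    rw [List.append_nil] at this
    rw [this]
    cases hc : c.drop n with
    | nil => simp [dominates]; rw [List.drop_eq_nil_iff] at hc; omega
    | cons b l =>
      simp only [dominates, Bool.false_eq_true, and_false, false_iff]
      rintro rfl
      simp at hc
  have hA' : ∀ n, A (encodeList x.reverse ++ encodeList (List.replicate n false).reverse) = true ↔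
      ∃ c, Good c ∧ c.length = n := by
    intro n
    rw [hA]
    constructor
    · rintro ⟨c, hc, hg⟩
      exact ⟨_, hg, by rw [List.length_reverse, ← (hdom n c).1 hc]⟩
    · rintro ⟨c, hg, rfl⟩
      exact ⟨c.reverse, by simp [hdom], by simpa using hg⟩
  have hex : ∃ n, ∃ c, Good c ∧ c.length = n := by
    obtain ⟨c, hg, -⟩ := hN; exact ⟨_, c, hg, rfl⟩
  have hle : Nat.find hex ≤ N := by
    obtain ⟨c, hg, hc⟩ := hN
    exact (Nat.find_le ⟨c, hg, rfl⟩).trans hc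
  have hmin : ∀ c, Good c → Nat.find hex ≤ c.length := fun c hg => Nat.find_le ⟨c, hg, rfl⟩
  have h1 := Frag.runs_findLength hM x ((hA' _).2 (Nat.find_spec hex)) fun m hm => by
    simpa using mt (hA' m).1 (Nat.find_min hex hm)
  have hspec := Nat.find_spec hex
  generalize Nat.find hex = n at *
  obtain ⟨d, hl, hg, h2⟩ := Frag.runs_findBits hM hA n [] (some true) (by
    simpa using (hA _).1 ((hA' n).2 hspec)) (by
    intro c hc _
    rw [List.append_nil, hdom] at hc
    simp [hc])
  have h3 := Frag.runs_move (M := M) .thd .out (by simp) ⟨none, none, true⟩ M.tm.initialState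
    (locs x [] [] [] d) fun _ => []
  have h4 := Frag.runs_clear (M := M) .inp ⟨none, none, true⟩ M.tm.initialState
    (locs x d.reverse [] [] []) fun _ => []
  simp only [locs_thd, locs_out, update_locs_thd, update_locs_out, List.append_nil, locs_inp,
    update_locs_inp] at h3 h4
  simp only [List.length_nil, Nat.add_zero] at hl h2
  refine ⟨d.reverse, hg, fun c hc => by simpa [hl] using hmin c hc, ?_⟩
  rw [singleStack_inp, singleStack_out]
  refine (h1.seq <| h2.seq <| h3.seq <| h4.seq <| Frag.runs_ops' ?_).mono ?_
  · simp [State.rest]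
  · have hT := monotone_eval_nat (queryTime T) (show x.length + n ≤ x.length + N by omega)
    dsimp only at hT
    have ha := Nat.mul_le_mul (Nat.add_le_add_right hle 1) (Nat.add_le_add_right hT 2)
    have hb := Nat.mul_le_mul hle (Nat.add_le_add_right hT 3)
    omega

theorem exists_nat_polynomial_bound (q : Polynomial ℤ) :
    ∃ B : Polynomial ℕ, ∀ n : ℕ, q.eval (n : ℤ) ≤ B.eval n := by
  induction q using Polynomial.induction_on' with
  | add q r hq hr =>
    obtain ⟨B, hB⟩ := hq
    obtain ⟨B', hB'⟩ := hr
    exact ⟨B + B', fun n => by simpa using add_le_add (hB n) (hB' n)⟩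
  | monomial k a =>
    refine ⟨Polynomial.monomial k a.natAbs, fun n => ?_⟩
    simp only [Polynomial.eval_monomial, Nat.cast_mul, Nat.cast_pow, Int.natCast_natAbs]
    exact mul_le_mul_of_nonneg_right (le_abs_self a) (by positivity)

theorem exists_program_length_bound (U : BinTM) (p : Polynomial ℚ) : ∃ R : Polynomial ℕ,
    ∀ w x, OutputsWithin U w x (polyBound p x.length) → w.length ≤ R.eval x.length := by
  obtain ⟨D, q, hD, hq⟩ := exists_integer_bound p
  obtain ⟨C, hC⟩ := exists_opCount_le U.tm
  obtain ⟨B, hB⟩ := exists_nat_polynomial_bound q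
  refine ⟨Polynomial.X + Polynomial.C C * B, fun w x h => ?_⟩
  obtain ⟨j, hj, h⟩ := (outputsWithin_iff _ _ _ _).1 h
  have h1 := h.length_le hC U.tm.k₀
  have h2 : (singleStack U.tm.k₁ (x.map U.outputAlphabet.symm) U.tm.k₀).length ≤ x.length := by
    by_cases h : U.tm.k₀ = U.tm.k₁
    · rw [h]; simp [singleStack]
    · simp [singleStack, h]
  have h3 : j ≤ B.eval x.length := by
    have h4 := ((hq _ _).1 hj).trans (hB _)
    exact (Nat.le_mul_of_pos_left j hD).trans (by exact_mod_cast h4)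
  have h4 := Nat.mul_le_mul_left C h3
  simp [singleStack] at h1 h2 ⊢
  omega

theorem exists_decides_of_mem_classP {A : Language Bool} (hA : A ∈ ClassP) :
    ∃ (M : BinTM) (f : List Bool → Bool) (T : Polynomial ℕ), Decides M f T ∧
      ∀ z, f z = true ↔ z ∈ A := by
  obtain ⟨M⟩ := hA
  exact ⟨M.toTM2ComputableAux, _, M.time, fun z =>
    (nonempty_outputsInTime_iff _ _ _ _).1 ⟨M.outputsFun z⟩, fun z => by simp⟩

theorem timeBoundedComplexity_eq {U : BinTM} {t : ℕ → ℚ} {x w : List Bool}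
    (hw : OutputsWithin U w x (t x.length))
    (hmin : ∀ v, OutputsWithin U v x (t x.length) → w.length ≤ v.length) :
    timeBoundedComplexity U t x = w.length :=
  le_antisymm (iInf₂_le w hw) (le_iInf₂ fun v hv => by exact_mod_cast hmin v hv)

theorem exists_shortest_program_machine {U : BinTM} (hPNP : ClassP = ClassNP) {p : Polynomial ℚ}
    (hp : ∀ x, timeBoundedComplexity U (polyBound p) x ≠ ⊤) :
    ∃ (M : BinTM) (Q : Polynomial ℕ) (q : List Bool → List Bool),
      (∀ x, OutputsWithin M x (q x) (Q.eval x.length : ℕ)) ∧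
      (∀ x, OutputsWithin U (q x) x (polyBound p x.length)) ∧
      ∀ x, ((q x).length : ℕ∞) = timeBoundedComplexity U (polyBound p) x := by
  obtain ⟨M, f, T, hM, hf⟩ :=
    exists_decides_of_mem_classP (hPNP ▸ searchLanguage_mem_classNP U p)
  obtain ⟨R, hR⟩ := exists_program_length_bound U p
  have h : ∀ x, ∃ d, OutputsWithin U d x (polyBound p x.length) ∧
      (∀ c, OutputsWithin U c x (polyBound p x.length) → d.length ≤ c.length) ∧
      Frag.search.Runs (State.rest (M := M) (singleStack .inp x))
        (State.rest (singleStack .out d)) _ := fun x =>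
    Frag.exists_runs_search hM (Good := fun c => OutputsWithin U c x (polyBound p x.length))
      (fun l => (hf _).trans (mem_searchLanguage_iff U p x l)) (N := R.eval x.length) (by
        by_contra hc
        refine hp x ?_
        simp only [timeBoundedComplexity, iInf_eq_top]
        exact fun w hw => absurd ⟨w, hw, hR w x hw⟩ hc)
  choose q hq hmin hrun using h
  refine ⟨(Frag.search (M := M)).machine, (R + 1) * ((queryTime T).comp (Polynomial.X + R) + 2) +
    R * ((queryTime T).comp (Polynomial.X + R) + 3) + 2 * R + 2 * Polynomial.X + 5, q, fun x =>
      ⟨_, le_rfl, ?_⟩, hq, fun x => (timeBoundedComplexity_eq (hq x) (hmin x)).symm⟩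
  convert (hrun x).machine_outputs using 2
  · rfl
  · rfl
  · simp

theorem polyBound_natCast (Q : Polynomial ℕ) (n : ℕ) :
    polyBound (Q.map (Nat.castRingHom ℚ)) n = (Q.eval n : ℕ) := by
  simp [polyBound]

end TimeBoundedCompression

theorem mainTheorem5 (U : TimeBoundedCompression.BinTM)
    (hU : TimeBoundedCompression.IsUniversal U)
    (hPNP : TimeBoundedCompression.ClassP = TimeBoundedCompression.ClassNP)
    (p : Polynomial ℚ)
    (hp : ∀ x : List Bool, TimeBoundedCompression.timeBoundedComplexity U
      (TimeBoundedCompression.polyBound p) x ≠ ⊤) :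
    (∃ (p' : Polynomial ℚ) (q : List Bool → List Bool),
      TimeBoundedCompression.IsCompressionFunction U (TimeBoundedCompression.polyBound p')
        (TimeBoundedCompression.polyBound p) q ∧
      ∀ x : List Bool, ((q x).length : ℕ∞) =
        TimeBoundedCompression.timeBoundedComplexity U (TimeBoundedCompression.polyBound p) x) ∧
    (TimeBoundedCompression.HasPolynomialOverhead U →
      ∃ (p' : Polynomial ℚ) (e : List Bool) (q : List Bool → List Bool),
        TimeBoundedCompression.IsCompressionProgram U (TimeBoundedCompression.polyBound p')
          (TimeBoundedCompression.polyBound p) e q ∧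
        ∀ x : List Bool, ((q x).length : ℕ∞) =
          TimeBoundedCompression.timeBoundedComplexity U
            (TimeBoundedCompression.polyBound p) x) := by
  obtain ⟨M, Q, q, hM, hq, hlen⟩ := TimeBoundedCompression.exists_shortest_program_machine hPNP hp
  refine ⟨⟨Q.map (Nat.castRingHom ℚ), q, ⟨⟨M, fun x => ?_⟩, hq⟩, hlen⟩, fun hover => ?_⟩
  · rw [TimeBoundedCompression.polyBound_natCast]
    exact hM x
  · obtain ⟨e, r, he⟩ := hover M
    refine ⟨(r.comp (Polynomial.X + Q)).map (Nat.castRingHom ℚ), e, q, ⟨fun x => ?_, hq⟩, hlen⟩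
    rw [TimeBoundedCompression.polyBound_natCast]
    simpa using he x (q x) _ (hM x)
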